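/- **Setting.** Let $d\ge 1$, $R>0$ and $0<\lambda_{\min}<\lambda_{\max}$, and let $\mathbb S=\mathbb S_d^+(\lambda_{\min},\lambda_{\max})$ be the set of symmetric positive-definite real $d\times d$ matrices with all eigenvalues in $[\lambda_{\min},\lambda_{\max}]$. For symmetric $S$ put $\|S\|_{\mathrm{op}}=\max_{\|v\|\le 1}|v^\top S v|$. For a measurable set $\mathcal X\subseteq \bar B(0,R)=\{x\in\mathbb R^d:\|x\|\le R\}$ let $\mathscr G$ be the set of all $G=P\times\delta_\Sigma$ with $P$ a Borel probability measure on $\mathbb R^d$, $\mathrm{supp}(P)\subseteq\mathcal X$, and $\Sigma\in\mathbb S$. The multivariate Laplace kernel is $$f(x\mid\theta,\Sigma)=\frac{2}{(2\pi)^{d/2}|\Sigma|^{1/2}}\left(\frac{q}{2}\right)^{\frac{2-d}{4}}B_{\frac{d-2}{2}}\big(\sqrt{2q}\big),\qquad q=(x-\theta)^\top\Sigma^{-1}(x-\theta),\quad x\neq\theta,$$ where $|\Sigma|$ is the determinant of $\Sigma$ and $B_\kappa(z)=\int_0^\infty e^{-z\cosh t}\cosh(\kappa t)\,dt$, $z>0$,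 is the modified Bessel function of the second kind. Write $\Phi_\Sigma(\xi)=\int_{\mathbb R^d} e^{i\xi^\top x}f(x\mid 0,\Sigma)\,dx$, $p_G(x)=\int f(x\mid\theta,\Sigma)\,P(d\theta)$ for $G=P\times\delta_\Sigma$, $\|p-p'\|_1=\int_{\mathbb R^d}|p(x)-p'(x)|\,dx$, and $W_1(P,P')=\inf_\pi\int\|\theta-\theta'\|\,\pi(d\theta,d\theta')$, the infimum being over all couplings $\pi$ of $P$ and $P'$. **Theorem.** All constants below are independent of $\mathcal X$. 1. (Ordinary smoothness of order $2$.) There are $c_1,c_2>0$ depending only on $\lambda_{\min},\lambda_{\max},d$ with $$c_1(1+\|\xi\|^2)^{-1}\le|\Phi_\Sigma(\xi)|\le c_2(1+\|\xi\|^2)^{-1}\qquad\text{for all }\xi\in\mathbb R^d,\ \Sigma\in\mathbb S.$$ 2. (Assumption 1 with $\Psi(t)=t$.) There is $C>0$ depending only on $R,\lambda_{\min},\lambda_{\max},d$ with $\|p_G-p_{G'}\|_1\ge C\,\|\Sigma-\Sigma'\|_{\mathrm{op}}$ for all $G=P\times\delta_\Sigma$ and $G'=P'\times\delta_{\Sigma'}$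 in $\mathscr G$. 3. (Assumption 2 with $\Xi(t)=t$, $p=2$.) There is $C>0$ depending only on $\lambda_{\min},\lambda_{\max},d$ with $$|\Phi_{\Sigma'}(\xi)-\Phi_\Sigma(\xi)|\le C\,\|\Sigma-\Sigma'\|_{\mathrm{op}}\,\|\xi\|^2\max\{|\Phi_{\Sigma'}(\xi)|,|\Phi_\Sigma(\xi)|\}\qquad\text{for all }\xi\in\mathbb R^d,\ \Sigma,\Sigma'\in\mathbb S.$$ 4. (PDE inversion condition of order $2$.) The operator $\mathcal T_\Sigma=\mathrm{Id}-\frac12\sum_{j,k=1}^d\Sigma_{jk}\,\partial_j\partial_k$ can be written as $\mathcal T_\Sigma=\sum_{|\nu|\le 2}c_\nu(\Sigma)\,\partial^\nu$ (sum over multi-indices $\nu\in\mathbb N^d$), where: for some $\nu$ with $|\nu|=2$, $c_\nu(\Sigma)\ne 0$ for every $\Sigma\in\mathbb S$; there is $L>0$ such that every $c_\nu$ is $L$-Lipschitz on $\mathbb S$ with respect to $\|\cdot\|_{\mathrm{op}}$; and for every $G=P\times\delta_\Sigma\in\mathscr G$ the function $p_G$ is locally integrable and $\mathcal T_\Sigma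 p_G=P$ in the sense of distributions, that is, $$\int_{\mathbb R^d}p_G(x)\sum_{|\nu|\le2}(-1)^{|\nu|}c_\nu(\Sigma)\,\partial^\nu\phi(x)\,dx=\int_{\mathbb R^d}\phi\,dP\qquad\text{for all }\phi\in C_c^\infty(\mathbb R^d).$$ 5. (Inverse bound.) Consequently, there is $C'>0$ depending only on $R,\lambda_{\min},\lambda_{\max},d$ such that $$\|p_G-p_{G'}\|_1\ \ge\ C'\left[W_1(P,P')^2+\|\Sigma-\Sigma'\|_{\mathrm{op}}\right]$$ for all $G=P\times\delta_\Sigma$ and $G'=P'\times\delta_{\Sigma'}$ in $\mathscr G$. -/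

import Mathlib

open MeasureTheory Set
open scoped ContDiff

noncomputable section

namespace LaplaceMixture

/-- The Euclidean space `ℝ^d`. -/
abbrev E (d : ℕ) := EuclideanSpace ℝ (Fin d)

/-- The quadratic form `vᵀ S v`. -/
def quadForm {d : ℕ} (S : Matrix (Fin d) (Fin d) ℝ) (v : E d) : ℝ :=
  v.ofLp ⬝ᵥ S.mulVec v.ofLp

/-- `‖S‖_op = max_{‖v‖ ≤ 1} |vᵀ S v|` (it is only applied to symmetric matrices). -/
def opNorm {d : ℕ} (S : Matrix (Fin d) (Fin d) ℝ) : ℝ :=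
  sSup ((fun v : E d => |quadForm S v|) '' Metric.closedBall 0 1)

/-- The symmetric positive-definite `d × d` matrices all of whose eigenvalues lie in
`[lmin, lmax]`. -/
def scaleSet (d : ℕ) (lmin lmax : ℝ) : Set (Matrix (Fin d) (Fin d) ℝ) :=
  {S | ∃ h : S.PosDef, ∀ i, h.isHermitian.eigenvalues i ∈ Icc lmin lmax}

/-- The modified Bessel function of the second kind of real order `κ`, for an argument `z > 0`,
through its classical integral representation. -/
def besselK (κ z : ℝ) : ℝ :=
  ∫ t in Ioi (0 : ℝ), Real.exp (-z * Real.cosh t) * Real.cosh (κ * t)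

/-- A family of kernels `f(x ∣ θ, S)`, written `f x θ S`. -/
abbrev Kernel (d : ℕ) := E d → E d → Matrix (Fin d) (Fin d) ℝ → ℝ

/-- The multivariate Laplace kernel. It is determined by this formula for `x ≠ θ`; the value on
the Lebesgue-null set `x = θ`, where the formula is singular, plays no role. -/
def laplaceKernel (d : ℕ) : Kernel d := fun x θ S =>
  2 * (quadForm S⁻¹ (x - θ) / 2) ^ ((2 - (d : ℝ)) / 4)
      * besselK (((d : ℝ) - 2) / 2) (Real.sqrt (2 * quadForm S⁻¹ (x - θ)))
    / ((2 * Real.pi) ^ ((d : ℝ) / 2) * S.det ^ ((1 : ℝ) / 2))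

/-- The characteristic function `Φ_S(ξ) = ∫ e^{i ξᵀx} f(x ∣ 0, S) dx`. -/
def kernelCharFun {d : ℕ} (f : Kernel d) (S : Matrix (Fin d) (Fin d) ℝ) (ξ : E d) : ℂ :=
  ∫ x : E d, Complex.exp (Complex.I * (inner ℝ ξ x : ℝ)) * (f x 0 S : ℂ)

/-- The data of a homoscedastic mixing measure `G = P × δ_S`: the location mixing measure `P`
and the common scale matrix `S`. -/
structure Mixing (d : ℕ) where
  /-- the location mixing measure -/
  P : Measure (E d)
  /-- the common scale matrix -/
  S : Matrix (Fin d) (Fin d) ℝ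

/-- The class of all `G = P × δ_S` with `P` a probability measure supported in `X` and `S`
a scale matrix with eigenvalues in `[lmin, lmax]`. -/
def mixingClass {d : ℕ} (X : Set (E d)) (lmin lmax : ℝ) : Set (Mixing d) :=
  {G | IsProbabilityMeasure G.P ∧ G.P.support ⊆ X ∧ G.S ∈ scaleSet d lmin lmax}

/-- The mixture density `p_G(x) = ∫ f(x ∣ θ, S) P(dθ)`. -/
def mixtureDensity {d : ℕ} (f : Kernel d) (G : Mixing d) (x : E d) : ℝ :=
  ∫ θ, f x θ G.S ∂G.P

/-- The `L¹` distance `‖p - p'‖₁` for Lebesgue measure. -/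
def l1Dist {d : ℕ} (p p' : E d → ℝ) : ℝ := ∫ x, |p x - p' x|

/-- The Wasserstein distance of order one for the Euclidean ground metric, as an infimum over
couplings. For measures with bounded support the infimum is finite. -/
def wasserstein1 {d : ℕ} (P P' : Measure (E d)) : ℝ :=
  (⨅ π ∈ {π : Measure (E d × E d) | π.map Prod.fst = P ∧ π.map Prod.snd = P'},
    ∫⁻ z, edist z.1 z.2 ∂π).toReal

/-- `f` is ordinary-smooth of order `β`. -/
def OrdinarySmooth {d : ℕ} (f : Kernel d) (lmin lmax β : ℝ) : Prop :=
  0 < β ∧ ∃ c₁ > 0, ∃ c₂ > 0, ∀ ξ : E d, ∀ S ∈ scaleSet d lmin lmax,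
    c₁ * (1 + ‖ξ‖ ^ β)⁻¹ ≤ ‖kernelCharFun f S ξ‖ ∧
      ‖kernelCharFun f S ξ‖ ≤ c₂ * (1 + ‖ξ‖ ^ β)⁻¹

/-- `Ψ` restricts to a strictly increasing function `[0, ∞) → [0, ∞)`. -/
def IncreasingGauge (Ψ : ℝ → ℝ) : Prop :=
  MapsTo Ψ (Ici 0) (Ici 0) ∧ StrictMonoOn Ψ (Ici 0)

/-- Identifiability of the scale in `L¹`: `‖p_G - p_G'‖₁ ≥ C Ψ(‖S - S'‖_op)`, with a constant
that is uniform over all location spaces `X` in the closed ball of radius `R`. -/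
def ScaleLowerBound {d : ℕ} (f : Kernel d) (R lmin lmax : ℝ) (Ψ : ℝ → ℝ) : Prop :=
  IncreasingGauge Ψ ∧ ∃ C > 0,
    ∀ X : Set (E d), MeasurableSet X → X ⊆ Metric.closedBall 0 R →
      ∀ G ∈ mixingClass X lmin lmax, ∀ G' ∈ mixingClass X lmin lmax,
        C * Ψ (opNorm (G.S - G'.S)) ≤ l1Dist (mixtureDensity f G) (mixtureDensity f G')

/-- Regularity of the characteristic function in the scale, with gauge `Ξ` and exponent `p`. -/
def ScaleRegularity {d : ℕ} (f : Kernel d) (lmin lmax : ℝ) (Ξ : ℝ → ℝ) (p : ℝ) : Prop :=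
  1 ≤ p ∧ IncreasingGauge Ξ ∧ ∃ C > 0,
    ∀ ξ : E d, ∀ S ∈ scaleSet d lmin lmax, ∀ S' ∈ scaleSet d lmin lmax,
      ‖kernelCharFun f S' ξ - kernelCharFun f S ξ‖ ≤
        C * Ξ (opNorm (S - S')) * ‖ξ‖ ^ p *
          max ‖kernelCharFun f S' ξ‖ ‖kernelCharFun f S ξ‖

/-- The partial derivative `∂φ/∂x_j`. -/
def pderiv {d : ℕ} (j : Fin d) (φ : E d → ℝ) : E d → ℝ :=
  fun x => fderiv ℝ φ x (EuclideanSpace.single j 1)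

/-- `∂^ν φ = ∂₁^{ν₁} ⋯ ∂_d^{ν_d} φ` for a multi-index `ν`. -/
def multiDeriv {d : ℕ} (ν : Fin d → ℕ) (φ : E d → ℝ) : E d → ℝ :=
  (List.finRange d).foldr (fun j g => (pderiv j)^[ν j] g) φ

/-- The finite set of multi-indices `ν` with `|ν| ≤ β`. -/
def multiIndices (d β : ℕ) : Finset (Fin d → ℕ) :=
  (Fintype.piFinset fun _ => Finset.range (β + 1)).filter fun ν => ∑ j, ν j ≤ β

theorem mem_multiIndices {d β : ℕ} {ν : Fin d → ℕ} :
    ν ∈ multiIndices d β ↔ ∑ j, ν j ≤ β := by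
  simp only [multiIndices, Finset.mem_filter, Fintype.mem_piFinset, Finset.mem_range,
    and_iff_right_iff_imp]
  intro h j
  exact Nat.lt_succ_of_le ((Finset.single_le_sum (fun _ _ => Nat.zero_le _)
    (Finset.mem_univ j)).trans h)

/-- The mixture densities `p_G`, `G` in the class given by `X`, `lmin` and `lmax`, satisfy a PDE
inversion condition of order `β` for the differential operator `T_S`, given by its action on smooth
functions: `T_S = ∑_{|ν| ≤ β} c_ν(S) ∂^ν`, a coefficient of order `β` does not vanish, the
coefficients are Lipschitz in `S`, and `T_S p_G = P` in the sense of distributions, that is,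
`⟨p_G, T_S^* φ⟩ = ∫ φ dP` for all test functions `φ`, with `T_S^* = ∑ (-1)^|ν| c_ν(S) ∂^ν`. -/
def PDEInversion {d : ℕ} (f : Kernel d) (X : Set (E d)) (lmin lmax : ℝ) (β : ℕ)
    (T : Matrix (Fin d) (Fin d) ℝ → (E d → ℝ) → E d → ℝ) : Prop :=
  ∃ c : (Fin d → ℕ) → Matrix (Fin d) (Fin d) ℝ → ℝ,
    (∀ S ∈ scaleSet d lmin lmax, ∀ φ : E d → ℝ, ContDiff ℝ ∞ φ → ∀ x,
      T S φ x = ∑ ν ∈ multiIndices d β, c ν S * multiDeriv ν φ x) ∧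
    (∃ ν : Fin d → ℕ, ∑ j, ν j = β ∧ ∀ S ∈ scaleSet d lmin lmax, c ν S ≠ 0) ∧
    (∃ L > 0, ∀ ν ∈ multiIndices d β,
      ∀ S ∈ scaleSet d lmin lmax, ∀ S' ∈ scaleSet d lmin lmax,
        |c ν S - c ν S'| ≤ L * opNorm (S - S')) ∧
    ∀ G ∈ mixingClass X lmin lmax,
      LocallyIntegrable (mixtureDensity f G) volume ∧
      ∀ φ : E d → ℝ, ContDiff ℝ ∞ φ → HasCompactSupport φ →
        ∫ x, mixtureDensity f G x *
            (∑ ν ∈ multiIndices d β, (-1 : ℝ) ^ (∑ j, ν j) * c ν G.S * multiDeriv ν φ x)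
          = ∫ x, φ x ∂G.P

/-- The operator `T_S = Id - (1/2) ∑_{j,k} S_{jk} ∂²/∂x_j∂x_k`. -/
def laplaceOp {d : ℕ} (S : Matrix (Fin d) (Fin d) ℝ) (φ : E d → ℝ) : E d → ℝ :=
  fun x => φ x - 1 / 2 * ∑ j, ∑ k, S j k * pderiv j (pderiv k φ) x

end LaplaceMixture

end

open LaplaceMixture

namespace LaplaceMixture

/-! The Laplace kernel is the density of `θ + √w • y`, where `w` is a standard exponential time and
`y` is Gaussian with covariance `S`. Substituting `w = √(q/2) eᵗ` in the mixture integral produces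
the Bessel formula (`integral_rpow_mul_exp_neg_add_div`, `laplaceKernel_eq_integral`).

Gaussian smoothing `u(w) = E φ(θ + √w y)` solves the heat equation `u' = E (φ - T_S φ)(θ + √w y)`,
by Stein's identity. Hence `-e^{-w} u(w)` is an antiderivative of `e^{-w} E (T_S φ)(θ + √w y)`, and
integrating over `w > 0` gives `∫ f(x ∣ θ, S) T_S φ(x) dx = φ(θ)`. So the kernel is the fundamental
solution of `T_S`, and it may be tested against every bounded C² function with bounded derivatives,
not only against compactly supported ones (`integral_laplaceKernel_mul_laplaceOp`). Averaging over
`θ` gives `T_S p_G = P`. Everything else is a choice of test function.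

Plane waves are eigenfunctions of `T_S`, so `Φ_S(ξ) = 1 / (1 + ξᵀSξ/2)`; ordinary smoothness and
scale regularity are then elementary inequalities. Compactly supported test functions give the PDE
inversion.

For the scale bound, test with `φ(x) = ψ(⟨v, x⟩)`, where `v` is a unit vector and `ψ` a bump lying
beyond `R`. Both `P` and `P'` give `φ` integral zero, so only the mismatch of the operators remains:
`∫ (p - p') T_S φ = (s - s')/s' ∫ p' φ` with `s = vᵀSv`, `s' = vᵀS'v`. The last integral is bounded
below because the kernel is positive, uniformly on bounded sets.

For the inverse bound, Kantorovich duality reduces `W₁` to bounded 1-Lipschitz functions. Smooth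
such a function at scale `δ` into `F`, with second derivatives `O(1/δ)`, and write `∫ F dP - ∫ F dP'
= ∫ (p - p') T_S F + ∫ p' (T_S - T_{S'}) F`. With `l = ‖p - p'‖₁`, the scale bound controls the
second term by `l/δ` as well, so `W₁ ≤ 2δ + O(l (1 + δ + 1/δ))`. Taking `δ = √l` yields `W₁² =
O(l)`. -/

/-! ### Quadratic forms and the operator norm. -/

open Matrix in
theorem quadForm_eq_inner {d : ℕ} (S : Matrix (Fin d) (Fin d) ℝ) (v : E d) :
    quadForm S v = inner ℝ v (toEuclideanLin S v) := by
  simp [quadForm, EuclideanSpace.inner_eq_star_dotProduct, dotProduct_comm]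

open Matrix in
theorem quadForm_eq_sum {d : ℕ} (S : Matrix (Fin d) (Fin d) ℝ) (v : E d) :
    quadForm S v = ∑ j, ∑ k, S j k * (v j * v k) := by
  simp only [quadForm, dotProduct, mulVec, Finset.mul_sum]
  exact Finset.sum_congr rfl fun j _ => Finset.sum_congr rfl fun k _ => by ring

theorem quadForm_sub {d : ℕ} (S S' : Matrix (Fin d) (Fin d) ℝ) (v : E d) :
    quadForm (S - S') v = quadForm S v - quadForm S' v := by
  simp [quadForm, Matrix.sub_mulVec]

theorem quadForm_smul {d : ℕ} (S : Matrix (Fin d) (Fin d) ℝ) (t : ℝ) (v : E d) :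
    quadForm S (t • v) = t ^ 2 * quadForm S v := by
  simp [quadForm, Matrix.mulVec_smul]; ring

theorem continuous_quadForm {d : ℕ} (S : Matrix (Fin d) (Fin d) ℝ) :
    Continuous (quadForm S) := by
  have : quadForm S = fun v => ∑ j, ∑ k, S j k * (v j * v k) := funext (quadForm_eq_sum S)
  rw [this]
  fun_prop

theorem bddAbove_abs_quadForm {d : ℕ} (S : Matrix (Fin d) (Fin d) ℝ) :
    BddAbove ((fun v : E d => |quadForm S v|) '' Metric.closedBall 0 1) :=
  ((isCompact_closedBall (0 : E d) 1).image (continuous_quadForm S).abs).bddAbove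

theorem opNorm_nonneg {d : ℕ} (S : Matrix (Fin d) (Fin d) ℝ) : 0 ≤ opNorm S :=
  (abs_nonneg _).trans (le_csSup (bddAbove_abs_quadForm S)
    (mem_image_of_mem _ (Metric.mem_closedBall_self zero_le_one)))

theorem abs_quadForm_le {d : ℕ} (S : Matrix (Fin d) (Fin d) ℝ) (v : E d) :
    |quadForm S v| ≤ opNorm S * ‖v‖ ^ 2 := by
  rcases eq_or_ne v 0 with rfl | hv
  · simp [quadForm]
  have hn : 0 < ‖v‖ := norm_pos_iff.2 hv
  have h1 : |quadForm S (‖v‖⁻¹ • v)| ≤ opNorm S := by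
    refine le_csSup (bddAbove_abs_quadForm S) (mem_image_of_mem (fun v : E d => |quadForm S v|) ?_)
    simp [norm_smul, hn.ne']
  rw [quadForm_smul, abs_mul, abs_of_nonneg (by positivity)] at h1
  field_simp at h1
  linarith

/-- A bound for `|quadForm S v|` on the unit sphere is a bound for the operator norm. -/
theorem opNorm_le {d : ℕ} {S : Matrix (Fin d) (Fin d) ℝ} {M : ℝ} (hM : 0 ≤ M)
    (h : ∀ v : E d, ‖v‖ = 1 → |quadForm S v| ≤ M) : opNorm S ≤ M := by
  refine csSup_le ⟨_, mem_image_of_mem _ (Metric.mem_closedBall_self zero_le_one)⟩ ?_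
  rintro _ ⟨v, hv, rfl⟩
  rcases eq_or_ne v 0 with rfl | hv0
  · simpa [quadForm] using hM
  have hn : 0 < ‖v‖ := norm_pos_iff.2 hv0
  have hv1 : ‖v‖ ≤ 1 := by simpa using hv
  have h1 := h (‖v‖⁻¹ • v) (by simp [norm_smul, hn.ne'])
  rw [quadForm_smul, abs_mul, abs_of_nonneg (by positivity)] at h1
  field_simp at h1
  nlinarith [pow_le_one₀ hn.le hv1 (n := 2)]

/-- Polarization: twice the entry is the form at `e_j + e_k` minus its values at `e_j` and `e_k`. As
`‖e_j + e_k‖² ≤ 4`, the constant is `(4 + 1 + 1)/2 = 3`. -/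
theorem abs_apply_le_opNorm {d : ℕ} {S : Matrix (Fin d) (Fin d) ℝ} (hS : S.IsSymm)
    (j k : Fin d) : |S j k| ≤ 3 * opNorm S := by
  have key : ∀ v w : E d, quadForm S (v + w) =
      quadForm S v + quadForm S w + 2 * (v.ofLp ⬝ᵥ S.mulVec w.ofLp) := by
    intro v w
    have : w.ofLp ⬝ᵥ S.mulVec v.ofLp = v.ofLp ⬝ᵥ S.mulVec w.ofLp := by
      rw [dotProduct_comm, ← Matrix.vecMul_transpose, hS.eq, ← Matrix.dotProduct_mulVec]
    simp only [quadForm, WithLp.ofLp_add, Matrix.mulVec_add, dotProduct_add, add_dotProduct, this]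
    ring
  have h := key (EuclideanSpace.single j 1) (EuclideanSpace.single k 1)
  have h0 : (EuclideanSpace.single j (1 : ℝ)).ofLp ⬝ᵥ
      S.mulVec (EuclideanSpace.single k (1 : ℝ)).ofLp = S j k := by simp
  rw [h0] at h
  have h1 := abs_quadForm_le S (EuclideanSpace.single j (1 : ℝ))
  have h2 := abs_quadForm_le S (EuclideanSpace.single k (1 : ℝ))
  have h3 := abs_quadForm_le S (EuclideanSpace.single j (1 : ℝ) + EuclideanSpace.single k 1)
  have h4 : ‖EuclideanSpace.single j (1 : ℝ) + EuclideanSpace.single k (1 : ℝ)‖ ≤ 2 := by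
    refine (norm_add_le _ _).trans ?_
    simp; norm_num
  have h5 : ‖EuclideanSpace.single j (1 : ℝ) + EuclideanSpace.single k (1 : ℝ)‖ ^ 2 ≤ 4 := by
    nlinarith [norm_nonneg (EuclideanSpace.single j (1 : ℝ) + EuclideanSpace.single k (1 : ℝ))]
  have h6 := mul_le_mul_of_nonneg_left h5 (opNorm_nonneg S)
  simp only [PiLp.norm_single, norm_one, one_pow, mul_one] at h1 h2
  rw [abs_le] at *
  constructor <;> linarith

/-! ### Matrices with spectrum in `[lmin, lmax]` and their inverses. -/

section ScaleSet

variable {d : ℕ} {lmin lmax : ℝ} {S : Matrix (Fin d) (Fin d) ℝ}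

theorem isSymm_of_mem_scaleSet (hS : S ∈ scaleSet d lmin lmax) : S.IsSymm := by
  obtain ⟨h, -⟩ := hS
  simpa [Matrix.IsHermitian, Matrix.IsSymm, Matrix.conjTranspose_eq_transpose_of_trivial]
    using h.isHermitian

open Matrix in
theorem quadForm_eq_sum_eigenvalues (h : S.IsHermitian) (v : E d) :
    quadForm S v = ∑ i, h.eigenvalues i * inner ℝ (h.eigenvectorBasis i) v ^ 2 := by
  rw [quadForm_eq_inner, ← h.eigenvectorBasis.sum_inner_mul_inner]
  refine Finset.sum_congr rfl fun i _ => ?_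
  have h1 : inner ℝ (h.eigenvectorBasis i) (toEuclideanLin S v) =
      inner ℝ (toEuclideanLin S (h.eigenvectorBasis i)) v :=
    ((isSymmetric_toEuclideanLin_iff.2 h) _ _).symm
  have h2 : toEuclideanLin S (h.eigenvectorBasis i) =
      h.eigenvalues i • h.eigenvectorBasis i := by
    apply (WithLp.equiv 2 _).injective
    exact h.mulVec_eigenvectorBasis i
  rw [h1, h2, inner_smul_left, real_inner_comm]
  simp
  ring

theorem le_quadForm_of_mem_scaleSet (hS : S ∈ scaleSet d lmin lmax) (v : E d) :
    lmin * ‖v‖ ^ 2 ≤ quadForm S v := by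
  obtain ⟨h, hl⟩ := hS
  rw [quadForm_eq_sum_eigenvalues h.isHermitian, ← h.isHermitian.eigenvectorBasis.sum_sq_norm_inner_right v,
    Finset.mul_sum]
  refine Finset.sum_le_sum fun i _ => ?_
  rw [Real.norm_eq_abs, sq_abs]
  exact mul_le_mul_of_nonneg_right (hl i).1 (sq_nonneg _)

theorem quadForm_le_of_mem_scaleSet (hS : S ∈ scaleSet d lmin lmax) (v : E d) :
    quadForm S v ≤ lmax * ‖v‖ ^ 2 := by
  obtain ⟨h, hl⟩ := hS
  rw [quadForm_eq_sum_eigenvalues h.isHermitian, ← h.isHermitian.eigenvectorBasis.sum_sq_norm_inner_right v,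
    Finset.mul_sum]
  refine Finset.sum_le_sum fun i _ => ?_
  rw [Real.norm_eq_abs, sq_abs]
  exact mul_le_mul_of_nonneg_right (hl i).2 (sq_nonneg _)

theorem det_pos_of_mem_scaleSet (hS : S ∈ scaleSet d lmin lmax) : 0 < S.det := hS.1.det_pos

theorem det_le_of_mem_scaleSet (hmin : 0 < lmin) (hS : S ∈ scaleSet d lmin lmax) :
    S.det ≤ lmax ^ d := by
  obtain ⟨h, hl⟩ := hS
  rw [h.isHermitian.det_eq_prod_eigenvalues]
  calc ∏ i, ((h.isHermitian.eigenvalues i : ℝ)) ≤ ∏ _i : Fin d, lmax :=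
        Finset.prod_le_prod (fun i _ => hmin.le.trans (hl i).1) fun i _ => (hl i).2
    _ = lmax ^ d := by simp

theorem mulVec_inv_mulVec_of_mem_scaleSet (hS : S ∈ scaleSet d lmin lmax) (y : Fin d → ℝ) :
    S.mulVec (S⁻¹.mulVec y) = y := by
  rw [Matrix.mulVec_mulVec, Matrix.mul_nonsing_inv _ (det_pos_of_mem_scaleSet hS).ne'.isUnit,
    Matrix.one_mulVec]

theorem quadForm_inv_eq (hS : S ∈ scaleSet d lmin lmax) (y : E d) :
    quadForm S⁻¹ y = quadForm S (WithLp.toLp 2 (S⁻¹.mulVec y.ofLp)) := by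
  simp only [quadForm, mulVec_inv_mulVec_of_mem_scaleSet hS]
  exact dotProduct_comm _ _

/-- With `z = S⁻¹y` the form equals both `⟨z, y⟩` and `zᵀSz ≥ lmin ‖z‖²`. Cauchy–Schwarz gives `lmin
‖z‖ ≤ ‖y‖`, and a second use of it bounds `⟨z, y⟩`. -/
theorem quadForm_inv_le (hmin : 0 < lmin) (hS : S ∈ scaleSet d lmin lmax) (y : E d) :
    quadForm S⁻¹ y ≤ ‖y‖ ^ 2 / lmin := by
  set z : E d := WithLp.toLp 2 (S⁻¹.mulVec y.ofLp) with hz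
  have h1 : quadForm S⁻¹ y = inner ℝ z y := by
    simp [quadForm, EuclideanSpace.inner_eq_star_dotProduct, hz]
  have h2 := real_inner_le_norm z y
  have h3 := le_quadForm_of_mem_scaleSet hS z
  rw [← quadForm_inv_eq hS, h1] at h3
  rw [h1, le_div_iff₀ hmin]
  have h4 : lmin * ‖z‖ ≤ ‖y‖ := by
    rcases (norm_nonneg z).eq_or_lt with h0 | h0
    · rw [← h0]; simp
    · nlinarith
  nlinarith [norm_nonneg y, norm_nonneg z]

/-- Completing the square: expand `0 ≤ quadForm S (lmax⁻¹ y - S⁻¹y)` and bound `yᵀSy` by `lmax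
‖y‖²`. No spectral decomposition of the inverse is needed. -/
theorem le_quadForm_inv (hmax : 0 < lmax) (hmin : 0 < lmin) (hS : S ∈ scaleSet d lmin lmax)
    (y : E d) : ‖y‖ ^ 2 / lmax ≤ quadForm S⁻¹ y := by
  set z : E d := WithLp.toLp 2 (S⁻¹.mulVec y.ofLp) with hz
  have hsym := isSymm_of_mem_scaleSet hS
  have h0 : 0 ≤ quadForm S (lmax⁻¹ • y - z) :=
    (by positivity : 0 ≤ lmin * ‖lmax⁻¹ • y - z‖ ^ 2).trans (le_quadForm_of_mem_scaleSet hS _)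
  have hSz : S.mulVec z.ofLp = y.ofLp := mulVec_inv_mulVec_of_mem_scaleSet hS _
  have hzy : z.ofLp ⬝ᵥ S.mulVec y.ofLp = y.ofLp ⬝ᵥ y.ofLp := by
    rw [dotProduct_comm, ← Matrix.vecMul_transpose, hsym.eq, ← Matrix.dotProduct_mulVec, hSz]
  have hyy : y.ofLp ⬝ᵥ y.ofLp = ‖y‖ ^ 2 := by
    rw [← real_inner_self_eq_norm_sq, EuclideanSpace.inner_eq_star_dotProduct]; simp
  have h1 : quadForm S (lmax⁻¹ • y - z) =
      lmax⁻¹ ^ 2 * quadForm S y - 2 * lmax⁻¹ * ‖y‖ ^ 2 + quadForm S⁻¹ y := by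
    rw [quadForm_inv_eq hS, ← hz]
    simp only [quadForm, WithLp.ofLp_sub, WithLp.ofLp_smul, Matrix.mulVec_sub, Matrix.mulVec_smul,
      dotProduct_sub, sub_dotProduct, smul_dotProduct, dotProduct_smul, hSz, hzy, smul_eq_mul, hyy]
    ring
  have h2 := mul_le_mul_of_nonneg_left (quadForm_le_of_mem_scaleSet hS y)
    (by positivity : 0 ≤ lmax⁻¹ ^ 2)
  have h3 : lmax⁻¹ ^ 2 * (lmax * ‖y‖ ^ 2) = lmax⁻¹ * ‖y‖ ^ 2 := by field_simp
  rw [div_eq_inv_mul]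
  linarith

theorem abs_apply_le_of_mem_scaleSet (hmin : 0 < lmin) (hmax : 0 < lmax)
    (hS : S ∈ scaleSet d lmin lmax) (j k : Fin d) : |S j k| ≤ 3 * lmax := by
  refine (abs_apply_le_opNorm (isSymm_of_mem_scaleSet hS) j k).trans ?_
  refine mul_le_mul_of_nonneg_left (opNorm_le hmax.le fun v hv => ?_) (by norm_num)
  have h1 := le_quadForm_of_mem_scaleSet hS v
  have h2 := quadForm_le_of_mem_scaleSet hS v
  rw [hv] at h1 h2
  rw [abs_le]
  constructor <;> linarith

-- A square root of `S⁻¹` provides the linear change of variables that normalizes the Gaussian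
-- integral.
open Matrix in
theorem exists_quadForm_inv_eq_norm_sq (hS : S ∈ scaleSet d lmin lmax) :
    ∃ B : Matrix (Fin d) (Fin d) ℝ, B.det ^ 2 = S.det⁻¹ ∧
      ∀ y : E d, quadForm S⁻¹ y = ‖toEuclideanLin B y‖ ^ 2 := by
  obtain ⟨B, hB⟩ : ∃ B : Matrix (Fin d) (Fin d) ℝ, S⁻¹ = star B * B := by
    open scoped MatrixOrder in
    exact CStarAlgebra.nonneg_iff_eq_star_mul_self.1 hS.1.inv.posSemidef.nonneg
  refine ⟨B, ?_, fun y => ?_⟩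
  · rw [← Ring.inverse_eq_inv', ← Matrix.det_nonsing_inv, hB]
    simp [Matrix.star_eq_conjTranspose, Matrix.det_mul, sq]
  · rw [← real_inner_self_eq_norm_sq, EuclideanSpace.inner_eq_star_dotProduct, quadForm, hB]
    simp [Matrix.star_eq_conjTranspose, ← Matrix.mulVec_mulVec, Matrix.dotProduct_mulVec,
      Matrix.conjTranspose_eq_transpose_of_trivial, Matrix.vecMul_transpose]

end ScaleSet

end LaplaceMixture

/-! ### Gaussian densities: integrability, total mass, gradient. -/

noncomputable section

namespace LaplaceMixture

/-- The density of the centred Gaussian law with covariance matrix `S`. -/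
def gaussDens {d : ℕ} (S : Matrix (Fin d) (Fin d) ℝ) (y : E d) : ℝ :=
  Real.exp (-(quadForm S⁻¹ y) / 2) / ((2 * Real.pi) ^ ((d : ℝ) / 2) * S.det ^ ((1 : ℝ) / 2))

theorem integrable_exp_neg_mul_norm_sq (d : ℕ) {b : ℝ} (hb : 0 < b) :
    Integrable fun y : E d => Real.exp (-b * ‖y‖ ^ 2) := by
  have h := GaussianFourier.integrable_cexp_neg_mul_sq_norm_add (V := E d) (b := (b : ℂ))
    (by simpa using hb) 0 0
  refine h.norm.congr (Filter.Eventually.of_forall fun y => ?_)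
  simp only [Complex.norm_exp, zero_mul, add_zero]
  norm_cast

section Gauss

variable {d : ℕ} {lmin lmax : ℝ} {S : Matrix (Fin d) (Fin d) ℝ}

theorem continuous_gaussDens (S : Matrix (Fin d) (Fin d) ℝ) : Continuous (gaussDens S) := by
  unfold gaussDens
  have := continuous_quadForm S⁻¹
  fun_prop

theorem gaussDens_norm_pos (hS : S ∈ scaleSet d lmin lmax) :
    0 < (2 * Real.pi) ^ ((d : ℝ) / 2) * S.det ^ ((1 : ℝ) / 2) := by
  have := det_pos_of_mem_scaleSet hS
  have := Real.pi_pos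
  positivity

theorem gaussDens_nonneg (hS : S ∈ scaleSet d lmin lmax) (y : E d) : 0 ≤ gaussDens S y :=
  div_nonneg (Real.exp_pos _).le (gaussDens_norm_pos hS).le

theorem gaussDens_le (hmax : 0 < lmax) (hmin : 0 < lmin) (hS : S ∈ scaleSet d lmin lmax)
    (y : E d) : gaussDens S y ≤
      ((2 * Real.pi) ^ ((d : ℝ) / 2) * S.det ^ ((1 : ℝ) / 2))⁻¹ *
        Real.exp (-(1 / (2 * lmax)) * ‖y‖ ^ 2) := by
  rw [gaussDens, div_eq_inv_mul]
  refine mul_le_mul_of_nonneg_left (Real.exp_le_exp.2 ?_) (inv_nonneg.2 (gaussDens_norm_pos hS).le)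
  have := le_quadForm_inv hmax hmin hS y
  have h2 : (1 / (2 * lmax)) * ‖y‖ ^ 2 = (‖y‖ ^ 2 / lmax) / 2 := by field_simp
  linarith

theorem integrable_gaussDens (hmax : 0 < lmax) (hmin : 0 < lmin) (hS : S ∈ scaleSet d lmin lmax) :
    Integrable (gaussDens S) := by
  refine ((integrable_exp_neg_mul_norm_sq d (b := 1 / (2 * lmax)) (by positivity)).const_mul
    ((2 * Real.pi) ^ ((d : ℝ) / 2) * S.det ^ ((1 : ℝ) / 2))⁻¹).mono'
    (continuous_gaussDens S).aestronglyMeasurable (Filter.Eventually.of_forall fun y => ?_)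
  rw [Real.norm_of_nonneg (gaussDens_nonneg hS y)]
  exact gaussDens_le hmax hmin hS y

theorem integrable_norm_mul_gaussDens (hmax : 0 < lmax) (hmin : 0 < lmin)
    (hS : S ∈ scaleSet d lmin lmax) : Integrable fun y => ‖y‖ * gaussDens S y := by
  set K := ((2 * Real.pi) ^ ((d : ℝ) / 2) * S.det ^ ((1 : ℝ) / 2))⁻¹ with hK
  have hK0 : 0 ≤ K := inv_nonneg.2 (gaussDens_norm_pos hS).le
  refine ((integrable_exp_neg_mul_norm_sq d (b := 1 / (4 * lmax)) (by positivity)).const_mul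
    (K * (1 + 4 * lmax))).mono'
    (continuous_norm.mul (continuous_gaussDens S)).aestronglyMeasurable
    (Filter.Eventually.of_forall fun y => ?_)
  rw [Real.norm_of_nonneg (mul_nonneg (norm_nonneg _) (gaussDens_nonneg hS y))]
  have h1 := gaussDens_le hmax hmin hS y
  rw [← hK] at h1
  -- Half of the Gaussian exponent is kept for integrability; the other half absorbs the factor
  -- `‖y‖`, through `1 + x ≤ eˣ`.
  have h2 : Real.exp (-(1 / (2 * lmax)) * ‖y‖ ^ 2) =
      Real.exp (-(1 / (4 * lmax)) * ‖y‖ ^ 2) * Real.exp (-((1 / (4 * lmax)) * ‖y‖ ^ 2)) := by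
    rw [← Real.exp_add]; congr 1; field_simp; ring
  have h3 : ‖y‖ ≤ (1 + 4 * lmax) * Real.exp ((1 / (4 * lmax)) * ‖y‖ ^ 2) := by
    have h4 := Real.add_one_le_exp ((1 / (4 * lmax)) * ‖y‖ ^ 2)
    have h5 : (1 + 4 * lmax) * ((1 / (4 * lmax)) * ‖y‖ ^ 2 + 1) =
        ‖y‖ ^ 2 + 1 + 4 * lmax + (1 / (4 * lmax)) * ‖y‖ ^ 2 := by field_simp; ring
    have h6 : 0 ≤ (1 / (4 * lmax)) * ‖y‖ ^ 2 := by positivity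
    nlinarith [sq_nonneg (‖y‖ - 1)]
  have h4 : ‖y‖ * Real.exp (-((1 / (4 * lmax)) * ‖y‖ ^ 2)) ≤ 1 + 4 * lmax := by
    rw [Real.exp_neg, ← div_eq_mul_inv, div_le_iff₀ (Real.exp_pos _)]
    exact h3
  calc ‖y‖ * gaussDens S y ≤ ‖y‖ * (K * Real.exp (-(1 / (2 * lmax)) * ‖y‖ ^ 2)) := by gcongr
    _ = K * (‖y‖ * Real.exp (-((1 / (4 * lmax)) * ‖y‖ ^ 2))) *
        Real.exp (-(1 / (4 * lmax)) * ‖y‖ ^ 2) := by rw [h2]; ring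
    _ ≤ K * (1 + 4 * lmax) * Real.exp (-(1 / (4 * lmax)) * ‖y‖ ^ 2) := by gcongr

-- The map `B` with `S⁻¹ = BᵀB` carries the integral to the standard Gaussian one, with Jacobian
-- `|det B|⁻¹ = √(det S)`.
open Matrix in
theorem integral_gaussDens (hS : S ∈ scaleSet d lmin lmax) : ∫ y, gaussDens S y = 1 := by
  obtain ⟨B, hdet, hB⟩ := exists_quadForm_inv_eq_norm_sq hS
  have hS0 := det_pos_of_mem_scaleSet hS
  have hBdet : LinearMap.det (toEuclideanLin B) = B.det := by simp
  have hB0 : LinearMap.det (toEuclideanLin B) ≠ 0 := by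
    rw [hBdet]; intro h
    rw [h] at hdet
    have := inv_pos.2 hS0
    rw [← hdet] at this
    simp at this
  have h2 := GaussianFourier.integral_rexp_neg_mul_sq_norm (V := E d) (b := 1 / 2) (by norm_num)
  have hmap := Measure.map_linearMap_addHaar_eq_smul_addHaar (volume : Measure (E d)) hB0
  have h3 : ∫ y : E d, Real.exp (-(quadForm S⁻¹ y) / 2) =
      |B.det|⁻¹ * ∫ y : E d, Real.exp (-(1 / 2) * ‖y‖ ^ 2) := by
    have hc : Continuous (toEuclideanLin B) := LinearMap.continuous_of_finiteDimensional _
    have h4 : ∫ z, Real.exp (-(1 / 2) * ‖z‖ ^ 2) ∂(Measure.map (toEuclideanLin B) volume) =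
        ∫ y : E d, Real.exp (-(quadForm S⁻¹ y) / 2) := by
      rw [integral_map hc.aemeasurable (by fun_prop)]
      refine integral_congr_ae (Filter.Eventually.of_forall fun y => ?_)
      simp only [hB]
      congr 1; ring
    rw [← h4, hmap, integral_smul_measure, hBdet, ENNReal.toReal_ofReal (abs_nonneg _), abs_inv,
      smul_eq_mul]
  have h5 : |B.det|⁻¹ = S.det ^ ((1 : ℝ) / 2) := by
    rw [← Real.sqrt_sq_eq_abs, hdet, ← Real.sqrt_inv, inv_inv, Real.sqrt_eq_rpow]
  simp only [gaussDens]
  rw [integral_div, h3, h2, h5]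
  have : Real.pi / (1 / 2) = 2 * Real.pi := by ring
  rw [this, finrank_euclideanSpace, Fintype.card_fin]
  have := gaussDens_norm_pos hS
  rw [mul_comm, div_self this.ne']

open Matrix in
theorem hasFDerivAt_gaussDens (hS : S ∈ scaleSet d lmin lmax) (y : E d) :
    ∃ L : E d →L[ℝ] ℝ, HasFDerivAt (gaussDens S) L y ∧
      ∀ v, L v = -inner ℝ (toEuclideanLin S⁻¹ y) v * gaussDens S y := by
  set A : E d →L[ℝ] E d := LinearMap.toContinuousLinearMap (toEuclideanLin S⁻¹) with hA
  have hsym : ∀ u v, inner ℝ (A u) v = inner ℝ u (A v) := by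
    have h : S⁻¹.IsHermitian := hS.1.inv.isHermitian
    exact fun u v => (isSymmetric_toEuclideanLin_iff.2 h) u v
  have hq : HasFDerivAt (fun y => inner ℝ y (A y)) _ y :=
    (hasFDerivAt_id y).inner ℝ A.hasFDerivAt
  have hf : gaussDens S = fun y => Real.exp ((inner ℝ y (A y)) * (-1 / 2)) *
      ((2 * Real.pi) ^ ((d : ℝ) / 2) * S.det ^ ((1 : ℝ) / 2))⁻¹ := by
    ext y
    rw [gaussDens, quadForm_eq_inner, div_eq_mul_inv]
    congr 2
    rw [hA, LinearMap.coe_toContinuousLinearMap']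
    ring
  rw [hf]
  refine ⟨_, ((hq.mul_const (-1 / 2)).exp.mul_const _), fun v => ?_⟩
  have : toEuclideanLin S⁻¹ y = A y := rfl
  rw [this]
  simp [fderivInnerCLM_apply]
  rw [← hsym y v, real_inner_comm v (A y)]
  ring

end Gauss

/-- Twice continuously differentiable functions that are bounded together with their partial
derivatives of order at most two. -/
def BoundedC2 {d : ℕ} (φ : E d → ℝ) : Prop :=
  ContDiff ℝ 2 φ ∧ ∃ M, ∀ x, |φ x| ≤ M ∧ (∀ k, |pderiv k φ x| ≤ M) ∧
    ∀ j k, |pderiv j (pderiv k φ) x| ≤ M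

theorem contDiff_pderiv {d : ℕ} {φ : E d → ℝ} {m n : WithTop ℕ∞} (hφ : ContDiff ℝ n φ)
    (hmn : m + 1 ≤ n) (k : Fin d) : ContDiff ℝ m (pderiv k φ) :=
  (hφ.fderiv_right hmn).clm_apply contDiff_const

theorem fderiv_apply_eq_sum {d : ℕ} (φ : E d → ℝ) (x y : E d) :
    fderiv ℝ φ x y = ∑ k, y k * pderiv k φ x := by
  have hy : y = ∑ k, y k • EuclideanSpace.single k (1 : ℝ) := by
    ext i
    simp [Finset.sum_apply, Pi.single_apply]
  conv_lhs => rw [hy]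
  simp [pderiv]

theorem pderiv_comp_add_smul {d : ℕ} {φ : E d → ℝ} (hφ : Differentiable ℝ φ) (θ : E d) (r : ℝ)
    (j : Fin d) (y : E d) :
    pderiv j (fun y => φ (θ + r • y)) y = r * pderiv j φ (θ + r • y) := by
  have h1 : HasFDerivAt (fun y : E d => θ + r • y) (r • ContinuousLinearMap.id ℝ (E d)) y :=
    ((hasFDerivAt_id y).const_smul r).const_add θ
  have h2 := (hφ (θ + r • y)).hasFDerivAt.comp y h1
  have h3 : fderiv ℝ (fun y => φ (θ + r • y)) y = _ := h2.fderiv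
  simp [pderiv, h3]

/-! ### Gaussian integration by parts. -/

section Stein

variable {d : ℕ} {lmin lmax : ℝ} {S : Matrix (Fin d) (Fin d) ℝ}

theorem integrable_bounded_mul_gaussDens (hmax : 0 < lmax) (hmin : 0 < lmin)
    (hS : S ∈ scaleSet d lmin lmax) {G : E d → ℝ} (hG : AEStronglyMeasurable G) {M : ℝ}
    (hM : ∀ y, |G y| ≤ M) : Integrable fun y => G y * gaussDens S y :=
  (integrable_gaussDens hmax hmin hS).bdd_mul (c := M) hG
    (Filter.Eventually.of_forall fun y => hM y)

theorem integrable_linear_mul_gaussDens (hmax : 0 < lmax) (hmin : 0 < lmin)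
    (hS : S ∈ scaleSet d lmin lmax) {G : E d → ℝ} (hG : AEStronglyMeasurable G) {M : ℝ}
    (hM : ∀ y, |G y| ≤ M * ‖y‖) : Integrable fun y => G y * gaussDens S y := by
  refine ((integrable_norm_mul_gaussDens hmax hmin hS).const_mul M).mono'
    (hG.mul (continuous_gaussDens S).aestronglyMeasurable) (Filter.Eventually.of_forall fun y => ?_)
  rw [norm_mul, Real.norm_eq_abs, Real.norm_of_nonneg (gaussDens_nonneg hS y), ← mul_assoc]
  exact mul_le_mul_of_nonneg_right (hM y) (gaussDens_nonneg hS y)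

open Matrix in
/-- Integration by parts against the Gaussian density. -/
theorem integral_inner_mul_gaussDens (hmax : 0 < lmax) (hmin : 0 < lmin)
    (hS : S ∈ scaleSet d lmin lmax) {G : E d → ℝ} (hG : Differentiable ℝ G) {M : ℝ}
    (hM : ∀ y, |G y| ≤ M) {j : Fin d} (hM' : ∀ y, |pderiv j G y| ≤ M) :
    ∫ y, (inner ℝ (toEuclideanLin S⁻¹ y) (EuclideanSpace.single j (1 : ℝ)) * G y)
        * gaussDens S y = ∫ y, pderiv j G y * gaussDens S y := by
  set e : E d := EuclideanSpace.single j (1 : ℝ) with he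
  have hg : Differentiable ℝ (gaussDens S) := fun y =>
    (hasFDerivAt_gaussDens hS y).choose_spec.1.differentiableAt
  have hg' : ∀ y, fderiv ℝ (gaussDens S) y e =
      -inner ℝ (toEuclideanLin S⁻¹ y) e * gaussDens S y := fun y => by
    obtain ⟨L, hL, h⟩ := hasFDerivAt_gaussDens hS y
    rw [hL.fderiv, h]
  set A : E d →L[ℝ] E d := LinearMap.toContinuousLinearMap (toEuclideanLin S⁻¹) with hA
  have hAy : ∀ y, toEuclideanLin S⁻¹ y = A y := fun _ => rfl
  have he1 : ‖e‖ = 1 := by simp [he]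
  have hM0 : 0 ≤ M := (abs_nonneg _).trans (hM 0)
  have hint : Integrable fun y => (-inner ℝ (A y) e * G y) * gaussDens S y := by
    refine integrable_linear_mul_gaussDens hmax hmin hS (M := ‖A‖ * M)
      (by have := hG.continuous; fun_prop) fun y => ?_
    rw [abs_mul, abs_neg]
    have h1 : |inner ℝ (A y) e| ≤ ‖A‖ * ‖y‖ := by
      refine (abs_real_inner_le_norm _ _).trans ?_
      rw [he1, mul_one]
      exact A.le_opNorm y
    calc |inner ℝ (A y) e| * |G y| ≤ (‖A‖ * ‖y‖) * M := by gcongr; exact hM y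
      _ = _ := by ring
  have key := integral_mul_fderiv_eq_neg_fderiv_mul_of_integrable (μ := volume) (f := G)
    (g := gaussDens S) (v := e)
    (integrable_bounded_mul_gaussDens hmax hmin hS
      (measurable_fderiv_apply_const ℝ G e).aestronglyMeasurable hM')
    (by
      refine hint.congr (Filter.Eventually.of_forall fun y => ?_)
      simp only [hg', hAy]; ring)
    (integrable_bounded_mul_gaussDens hmax hmin hS hG.continuous.aestronglyMeasurable hM)
    (fun x _ => hG x) (fun x _ => hg x)
  have h5 : ∫ y, (inner ℝ (toEuclideanLin S⁻¹ y) e * G y) * gaussDens S y =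
      -∫ y, G y * fderiv ℝ (gaussDens S) y e := by
    rw [← integral_neg]
    refine integral_congr_ae (Filter.Eventually.of_forall fun y => ?_)
    simp only [hg']; ring
  rw [h5, key, neg_neg]
  rfl

open Matrix in
/-- **Stein's identity** for the Gaussian law with covariance matrix `S`. -/
theorem integral_apply_mul_gaussDens (hmax : 0 < lmax) (hmin : 0 < lmin)
    (hS : S ∈ scaleSet d lmin lmax) {G : E d → ℝ} (hG : Differentiable ℝ G) {M : ℝ}
    (hM : ∀ y, |G y| ≤ M) (hM' : ∀ j y, |pderiv j G y| ≤ M) (k : Fin d) :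
    Integrable (fun y => (y k * G y) * gaussDens S y) ∧
    ∫ y, (y k * G y) * gaussDens S y = ∑ j, S k j * ∫ y, pderiv j G y * gaussDens S y := by
  have hM0 : 0 ≤ M := (abs_nonneg _).trans (hM 0)
  set A : E d →L[ℝ] E d := LinearMap.toContinuousLinearMap (toEuclideanLin S⁻¹) with hA
  refine ⟨integrable_linear_mul_gaussDens hmax hmin hS (M := M)
    (by have := hG.continuous; fun_prop) fun y => ?_, ?_⟩
  · rw [abs_mul, mul_comm]
    gcongr
    · exact hM y
    · exact PiLp.norm_apply_le y k
  -- Writing `y = S (S⁻¹y)` turns the coordinate `y k` into a combination of the factors produced by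
  -- differentiating the density.
  have hy : ∀ y : E d, y k = ∑ j, S k j * inner ℝ (toEuclideanLin S⁻¹ y)
      (EuclideanSpace.single j (1 : ℝ)) := fun y => by
    conv_lhs => rw [← mulVec_inv_mulVec_of_mem_scaleSet hS y.ofLp]
    simp [mulVec, dotProduct, EuclideanSpace.inner_single_right]
  have h1 : ∀ y, (y k * G y) * gaussDens S y = ∑ j, S k j * ((inner ℝ (toEuclideanLin S⁻¹ y)
      (EuclideanSpace.single j (1 : ℝ)) * G y) * gaussDens S y) := fun y => by
    rw [hy, Finset.sum_mul, Finset.sum_mul]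
    exact Finset.sum_congr rfl fun j _ => by ring
  simp_rw [h1]
  rw [integral_finsetSum]
  · refine Finset.sum_congr rfl fun j _ => ?_
    rw [integral_const_mul, integral_inner_mul_gaussDens hmax hmin hS hG hM (hM' j)]
  · intro j _
    refine Integrable.const_mul (integrable_linear_mul_gaussDens hmax hmin hS (M := ‖A‖ * M)
      ?_ fun y => ?_) _
    · have := hG.continuous
      have h : (fun y => inner ℝ (toEuclideanLin S⁻¹ y) (EuclideanSpace.single j (1 : ℝ)) * G y) =
        fun y => inner ℝ (A y) (EuclideanSpace.single j (1 : ℝ)) * G y := rfl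
      rw [h]; fun_prop
    · rw [abs_mul]
      have h1 : |inner ℝ (A y) (EuclideanSpace.single j (1 : ℝ))| ≤ ‖A‖ * ‖y‖ := by
        refine (abs_real_inner_le_norm _ _).trans ?_
        rw [PiLp.norm_single, norm_one, mul_one]
        exact A.le_opNorm y
      calc |inner ℝ (A y) (EuclideanSpace.single j (1 : ℝ))| * |G y| ≤ (‖A‖ * ‖y‖) * M := by
            gcongr; exact hM y
        _ = _ := by ring

end Stein

/-! ### Heat equation and resolvent of Gaussian smoothing. -/

section Heat

variable {d : ℕ} {lmin lmax : ℝ} {S : Matrix (Fin d) (Fin d) ℝ}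

theorem BoundedC2.exists_abs_laplaceOp_le {φ : E d → ℝ} (hφ : BoundedC2 φ)
    (S : Matrix (Fin d) (Fin d) ℝ) : ∃ M, ∀ x, |laplaceOp S φ x| ≤ M := by
  obtain ⟨-, M, hM⟩ := hφ
  refine ⟨M + 1 / 2 * ∑ j, ∑ k, |S j k| * M, fun x => ?_⟩
  unfold laplaceOp
  refine (abs_sub _ _).trans (add_le_add (hM x).1 ?_)
  rw [abs_mul, abs_of_pos (by norm_num : (0 : ℝ) < 1 / 2)]
  gcongr
  refine (Finset.abs_sum_le_sum_abs _ _).trans (Finset.sum_le_sum fun j _ => ?_)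
  refine (Finset.abs_sum_le_sum_abs _ _).trans (Finset.sum_le_sum fun k _ => ?_)
  rw [abs_mul]
  exact mul_le_mul_of_nonneg_left ((hM x).2.2 j k) (abs_nonneg _)

theorem continuous_laplaceOp {φ : E d → ℝ} (hφ : ContDiff ℝ 2 φ)
    (S : Matrix (Fin d) (Fin d) ℝ) : Continuous (laplaceOp S φ) := by
  have h1 : ∀ j k, Continuous (pderiv j (pderiv k φ)) := fun j k =>
    (contDiff_pderiv (m := 0) (contDiff_pderiv (m := 1) hφ (by norm_num) k) (by norm_num) j).continuous
  have := hφ.continuous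
  unfold laplaceOp
  fun_prop

/-- Smoothing a bounded continuous function by Gaussian noise is continuous in the noise level. -/
theorem continuous_integral_comp_gaussDens (hmax : 0 < lmax) (hmin : 0 < lmin)
    (hS : S ∈ scaleSet d lmin lmax) {H : E d → ℝ} (hH : Continuous H) {M : ℝ}
    (hM : ∀ y, |H y| ≤ M) (θ : E d) :
    Continuous fun w : ℝ => ∫ y, H (θ + Real.sqrt w • y) * gaussDens S y := by
  refine continuous_of_dominated (bound := fun y => M * gaussDens S y) (fun w => ?_) (fun w => ?_)
    ((integrable_gaussDens hmax hmin hS).const_mul M) ?_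
  · have := continuous_gaussDens S
    exact Continuous.aestronglyMeasurable (by fun_prop)
  · refine Filter.Eventually.of_forall fun y => ?_
    rw [norm_mul, Real.norm_of_nonneg (gaussDens_nonneg hS y)]
    exact mul_le_mul_of_nonneg_right (hM _) (gaussDens_nonneg hS y)
  · refine Filter.Eventually.of_forall fun y => ?_
    fun_prop

theorem abs_integral_mul_gaussDens_le (hmax : 0 < lmax) (hmin : 0 < lmin)
    (hS : S ∈ scaleSet d lmin lmax) {H : E d → ℝ} {M : ℝ} (hM : ∀ y, |H y| ≤ M) :
    |∫ y, H y * gaussDens S y| ≤ M := by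
  calc |∫ y, H y * gaussDens S y| ≤ ∫ y, M * gaussDens S y := by
        rw [← Real.norm_eq_abs]
        refine norm_integral_le_of_norm_le ((integrable_gaussDens hmax hmin hS).const_mul M)
          (Filter.Eventually.of_forall fun y => ?_)
        rw [norm_mul, Real.norm_of_nonneg (gaussDens_nonneg hS y)]
        exact mul_le_mul_of_nonneg_right (hM _) (gaussDens_nonneg hS y)
    _ = M := by rw [integral_const_mul, integral_gaussDens hS, mul_one]

/-- Stein's identity applied to each `∂_k φ(θ + r y)` gives `r ∑ S_{jk} E ∂_j ∂_k φ`, and the double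
sum is `2 (φ - T_S φ)`. The outer factor `r = √w` will cancel the derivative `1/(2√w)` of the square
root. -/
theorem integral_fderiv_mul_gaussDens (hmax : 0 < lmax) (hmin : 0 < lmin)
    (hS : S ∈ scaleSet d lmin lmax) {φ : E d → ℝ} (hφ : BoundedC2 φ) (θ : E d) (r : ℝ) :
    ∫ y, fderiv ℝ φ (θ + r • y) y * gaussDens S y =
      r * (2 * (∫ y, φ (θ + r • y) * gaussDens S y)
        - 2 * ∫ y, laplaceOp S φ (θ + r • y) * gaussDens S y) := by
  obtain ⟨ML, hML⟩ := hφ.exists_abs_laplaceOp_le S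
  obtain ⟨hφ2, M, hM⟩ := hφ
  have hc1 : ∀ k, ContDiff ℝ 1 (pderiv k φ) := fun k => contDiff_pderiv hφ2 (by norm_num) k
  have hc2 : ∀ j k, Continuous (pderiv j (pderiv k φ)) := fun j k =>
    (contDiff_pderiv (m := 0) (hc1 k) (by norm_num) j).continuous
  have hM0 : 0 ≤ M := (abs_nonneg _).trans (hM 0).1
  have hst := fun k => integral_apply_mul_gaussDens hmax hmin hS
    (G := fun y => pderiv k φ (θ + r • y)) (M := M + |r| * M)
    (by have := (hc1 k).differentiable one_ne_zero; fun_prop)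
    (fun y => ((hM _).2.1 k).trans (by simp; positivity))
    (fun j y => by
      rw [pderiv_comp_add_smul ((hc1 k).differentiable (by norm_num)), abs_mul]
      have := mul_le_mul_of_nonneg_left ((hM (θ + r • y)).2.2 j k) (abs_nonneg r)
      linarith) k
  simp_rw [fderiv_apply_eq_sum, Finset.sum_mul]
  rw [integral_finsetSum _ fun k _ => (hst k).1, Finset.sum_congr rfl fun k _ => (hst k).2]
  simp_rw [fun k j y => pderiv_comp_add_smul ((hc1 k).differentiable (by norm_num)) θ r j y,
    mul_assoc, integral_const_mul]
  have hint : ∀ j k, Integrable fun y => pderiv j (pderiv k φ) (θ + r • y) * gaussDens S y :=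
    fun j k => integrable_bounded_mul_gaussDens hmax hmin hS
      (by have := hc2 j k; exact Continuous.aestronglyMeasurable (by fun_prop))
      (fun y => (hM _).2.2 j k)
  have h2 : 2 * (∫ y, φ (θ + r • y) * gaussDens S y)
        - 2 * ∫ y, laplaceOp S φ (θ + r • y) * gaussDens S y =
      ∑ j, ∑ k, S j k * ∫ y, pderiv j (pderiv k φ) (θ + r • y) * gaussDens S y := by
    rw [← mul_sub, ← integral_sub, ← integral_const_mul]
    · have : ∀ y, 2 * (φ (θ + r • y) * gaussDens S y - laplaceOp S φ (θ + r • y) * gaussDens S y) =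
        ∑ j, ∑ k, S j k * (pderiv j (pderiv k φ) (θ + r • y) * gaussDens S y) := fun y => by
        simp_rw [← mul_assoc, ← Finset.sum_mul]
        unfold laplaceOp
        ring
      have hint' : ∀ j, Integrable fun y =>
          ∑ k, S j k * (pderiv j (pderiv k φ) (θ + r • y) * gaussDens S y) :=
        fun j => integrable_finsetSum _ fun k _ => (hint j k).const_mul (S j k)
      simp_rw [this]
      rw [integral_finsetSum _ fun j _ => hint' j]
      refine Finset.sum_congr rfl fun j _ => ?_
      rw [integral_finsetSum _ fun k _ => (hint j k).const_mul (S j k)]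
      exact Finset.sum_congr rfl fun k _ => integral_const_mul _ _
    · exact integrable_bounded_mul_gaussDens hmax hmin hS
        (by have := hφ2.continuous; exact Continuous.aestronglyMeasurable (by fun_prop))
        (fun y => (hM _).1)
    · exact integrable_bounded_mul_gaussDens hmax hmin hS
        (by have := continuous_laplaceOp hφ2 S; exact Continuous.aestronglyMeasurable (by fun_prop))
        (fun y => hML _)
  rw [h2, Finset.sum_comm, Finset.mul_sum]
  refine Finset.sum_congr rfl fun j _ => ?_
  rw [Finset.mul_sum]
  refine Finset.sum_congr rfl fun k _ => ?_
  rw [(isSymm_of_mem_scaleSet hS).apply j k]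
  ring

/-- The heat equation for Gaussian smoothing. -/
theorem hasDerivAt_integral_comp_gaussDens (hmax : 0 < lmax) (hmin : 0 < lmin)
    (hS : S ∈ scaleSet d lmin lmax) {φ : E d → ℝ} (hφ : BoundedC2 φ) (θ : E d) {w : ℝ}
    (hw : 0 < w) :
    HasDerivAt (fun w : ℝ => ∫ y, φ (θ + Real.sqrt w • y) * gaussDens S y)
      ((∫ y, φ (θ + Real.sqrt w • y) * gaussDens S y)
        - ∫ y, laplaceOp S φ (θ + Real.sqrt w • y) * gaussDens S y) w := by
  have hfd := integral_fderiv_mul_gaussDens hmax hmin hS hφ θ (Real.sqrt w)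
  obtain ⟨hφ2, M, hM⟩ := hφ
  have hM0 : 0 ≤ M := (abs_nonneg _).trans (hM 0).1
  have hdφ : Continuous (fderiv ℝ φ) := hφ2.continuous_fderiv (by norm_num)
  have hgc := continuous_gaussDens S
  have hφc := hφ2.continuous
  -- The derivative of `√w` blows up at `0`, so the domination is made only on `(w/2, ∞)`.
  have hs : Ioi (w / 2) ∈ nhds w := Ioi_mem_nhds (by linarith)
  have hsw : 0 < Real.sqrt w := Real.sqrt_pos.2 hw
  have hbound : ∀ x y, |fderiv ℝ φ x y| ≤ (d * M) * ‖y‖ := fun x y => by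
    rw [fderiv_apply_eq_sum]
    refine (Finset.abs_sum_le_sum_abs _ _).trans ?_
    calc ∑ k, |y k * pderiv k φ x| ≤ ∑ _k : Fin d, ‖y‖ * M := by
          refine Finset.sum_le_sum fun k _ => ?_
          rw [abs_mul]
          exact mul_le_mul (PiLp.norm_apply_le y k) ((hM x).2.1 k) (abs_nonneg _) (norm_nonneg _)
      _ = _ := by simp; ring
  have key := (hasDerivAt_integral_of_dominated_loc_of_deriv_le (μ := volume) (𝕜 := ℝ) (x₀ := w)
    (s := Ioi (w / 2)) (F := fun w y => φ (θ + Real.sqrt w • y) * gaussDens S y)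
    (F' := fun w y => (1 / (2 * Real.sqrt w)) * (fderiv ℝ φ (θ + Real.sqrt w • y) y * gaussDens S y))
    (bound := fun y => (1 / (2 * Real.sqrt (w / 2))) * (d * M) * (‖y‖ * gaussDens S y)) hs
    (Filter.Eventually.of_forall fun w => Continuous.aestronglyMeasurable (by fun_prop))
    (integrable_bounded_mul_gaussDens hmax hmin hS
      (Continuous.aestronglyMeasurable (by fun_prop)) (fun y => (hM _).1))
    (Continuous.aestronglyMeasurable (by fun_prop))
    (Filter.Eventually.of_forall fun y x hx => ?_)
    ((integrable_norm_mul_gaussDens hmax hmin hS).const_mul _)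
    (Filter.Eventually.of_forall fun y x hx => ?_)).2
  · rw [integral_const_mul, hfd] at key
    have e : ∀ a b : ℝ, 1 / (2 * Real.sqrt w) * (Real.sqrt w * (2 * a - 2 * b)) = a - b :=
      fun a b => by field_simp
    rw [e] at key
    exact key
  · have hx' : w / 2 < x := hx
    have h1 : Real.sqrt (w / 2) ≤ Real.sqrt x := Real.sqrt_le_sqrt hx'.le
    have h2 : 0 < Real.sqrt (w / 2) := Real.sqrt_pos.2 (by linarith)
    rw [norm_mul, norm_mul, Real.norm_of_nonneg (gaussDens_nonneg hS y),
      Real.norm_of_nonneg (by positivity), Real.norm_eq_abs]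
    have h3 := hbound (θ + Real.sqrt x • y) y
    have hg0 := gaussDens_nonneg hS y
    calc 1 / (2 * Real.sqrt x) * (|fderiv ℝ φ (θ + Real.sqrt x • y) y| * gaussDens S y)
        ≤ 1 / (2 * Real.sqrt (w / 2)) * ((d * M) * ‖y‖ * gaussDens S y) := by gcongr
      _ = _ := by ring
  · have hx' : w / 2 < x := hx
    have hx0 : 0 < x := by linarith
    have h1 : HasDerivAt (fun x : ℝ => θ + Real.sqrt x • y) ((1 / (2 * Real.sqrt x)) • y) x :=
      ((Real.hasDerivAt_sqrt hx0.ne').smul_const y).const_add θ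
    have h2 := ((hφ2.differentiable (by norm_num)) (θ + Real.sqrt x • y)).hasFDerivAt.comp_hasDerivAt x h1
    have h3 := h2.mul_const (gaussDens S y)
    refine h3.congr_deriv ?_
    rw [map_smul, smul_eq_mul, mul_assoc]

/-- The resolvent identity for Gaussian smoothing at an exponential time. -/
theorem integral_exp_mul_laplaceOp (hmax : 0 < lmax) (hmin : 0 < lmin)
    (hS : S ∈ scaleSet d lmin lmax) {φ : E d → ℝ} (hφ : BoundedC2 φ) (θ : E d) :
    ∫ w in Ioi (0 : ℝ), Real.exp (-w) *
      ∫ y, laplaceOp S φ (θ + Real.sqrt w • y) * gaussDens S y = φ θ := by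
  obtain ⟨ML, hML⟩ := hφ.exists_abs_laplaceOp_le S
  have hφ' := hφ
  obtain ⟨hφ2, M, hM⟩ := hφ'
  have hu := continuous_integral_comp_gaussDens hmax hmin hS hφ2.continuous (fun y => (hM y).1) θ
  have hv := continuous_integral_comp_gaussDens hmax hmin hS (continuous_laplaceOp hφ2 S) hML θ
  set u : ℝ → ℝ := fun w => ∫ y, φ (θ + Real.sqrt w • y) * gaussDens S y with hu'
  -- By the heat equation, `-e^{-w} u(w)` has derivative `e^{-w} E (T_S φ)`. It is only known to be
  -- differentiable for `w > 0`, but continuity at `0`, where `u(0) = φ(θ)`, is enough.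
  have key := integral_Ioi_of_hasDerivAt_of_tendsto (a := 0) (m := 0)
    (f := fun w => -(Real.exp (-w) * u w))
    (f' := fun w => Real.exp (-w) * ∫ y, laplaceOp S φ (θ + Real.sqrt w • y) * gaussDens S y)
    (Continuous.continuousWithinAt (by fun_prop)) (fun w hw => ?_) ?_ ?_
  · rw [key]
    simp [hu', integral_const_mul, integral_gaussDens hS]
  · have h1 := hasDerivAt_integral_comp_gaussDens hmax hmin hS hφ θ hw
    have h2 : HasDerivAt (fun w : ℝ => Real.exp (-w)) (-Real.exp (-w)) w := by
      simpa using (hasDerivAt_neg w).exp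
    exact (h2.mul h1).neg.congr_deriv (by ring)
  · refine ((integrableOn_exp_neg_Ioi 0).mul_const ML).mono'
      (Continuous.aestronglyMeasurable (by fun_prop)) (Filter.Eventually.of_forall fun w => ?_)
    rw [norm_mul, Real.norm_of_nonneg (Real.exp_pos _).le]
    exact mul_le_mul_of_nonneg_left (abs_integral_mul_gaussDens_le hmax hmin hS fun y => hML _)
      (Real.exp_pos _).le
  · refine squeeze_zero_norm (a := fun w => Real.exp (-w) * M) (fun w => ?_) ?_
    · rw [norm_neg, norm_mul, Real.norm_of_nonneg (Real.exp_pos _).le]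
      exact mul_le_mul_of_nonneg_left (abs_integral_mul_gaussDens_le hmax hmin hS fun y => (hM _).1)
        (Real.exp_pos _).le
    · simpa using (Real.tendsto_exp_neg_atTop_nhds_zero).mul_const M

end Heat

/-! ### Bessel functions as integrals over Gaussian scales. -/

section Bessel

/-- The only danger is the singularity at `w = 0`. From `xᵈ/d! ≤ eˣ` one gets `e^{-q/(2w)} ≤ d!
(2w/q)ᵈ`, which leaves the Gamma integrand `e^{-w} w^{d/2}`. -/
theorem integrableOn_rpow_mul_exp_neg_add_div (d : ℕ) {q : ℝ} (hq : 0 < q) :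
    IntegrableOn (fun w : ℝ => w ^ (-((d : ℝ) / 2)) * Real.exp (-w - q / (2 * w))) (Ioi 0) := by
  have hG := (Real.GammaIntegral_convergent (s := (d : ℝ) / 2 + 1) (by positivity)).const_mul
    (d.factorial * (2 / q) ^ d)
  refine hG.mono' (Measurable.aestronglyMeasurable (by fun_prop)) ?_
  refine (ae_restrict_iff' measurableSet_Ioi).2 (Filter.Eventually.of_forall fun w hw => ?_)
  have hw : 0 < w := hw
  rw [Real.norm_of_nonneg (by positivity)]
  have h1 := Real.pow_div_factorial_le_exp (q / (2 * w)) (by positivity) d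
  have h2 : Real.exp (-(q / (2 * w))) ≤ d.factorial * (2 / q) ^ d * w ^ d := by
    rw [Real.exp_neg]
    refine (inv_anti₀ (by positivity) h1).trans (le_of_eq ?_)
    rw [inv_div, div_eq_mul_inv, ← inv_pow, inv_div, mul_assoc, ← mul_pow]
    congr 2; field_simp
  have h3 : w ^ (-((d : ℝ) / 2)) * w ^ d = w ^ ((d : ℝ) / 2 + 1 - 1) := by
    rw [← Real.rpow_natCast w d, ← Real.rpow_add hw]; congr 1; ring
  calc w ^ (-((d : ℝ) / 2)) * Real.exp (-w - q / (2 * w))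
      = w ^ (-((d : ℝ) / 2)) * (Real.exp (-w) * Real.exp (-(q / (2 * w)))) := by
        rw [← Real.exp_add]; rfl
    _ ≤ w ^ (-((d : ℝ) / 2)) * (Real.exp (-w) * (d.factorial * (2 / q) ^ d * w ^ d)) := by
        gcongr
    _ = d.factorial * (2 / q) ^ d * (Real.exp (-w) * w ^ ((d : ℝ) / 2 + 1 - 1)) := by
        rw [← h3]; ring

/-- The Bessel function as an integral over the scale of a Gaussian. -/
theorem integral_rpow_mul_exp_neg_add_div (d : ℕ) {q : ℝ} (hq : 0 < q) :
    ∫ w in Ioi (0 : ℝ), w ^ (-((d : ℝ) / 2)) * Real.exp (-w - q / (2 * w)) =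
      2 * (q / 2) ^ ((2 - (d : ℝ)) / 4) *
        besselK (((d : ℝ) - 2) / 2) (Real.sqrt (2 * q)) := by
  -- The scale `a` is the one for which `w = a eᵗ` symmetrizes the exponent: `w + q/(2w) = 2a cosh
  -- t`, with `2a = √(2q)`.
  set a := Real.sqrt (q / 2) with ha
  have ha0 : 0 < a := Real.sqrt_pos.2 (by positivity)
  have ha2 : a ^ 2 = q / 2 := Real.sq_sqrt (by positivity)
  have hz : Real.sqrt (2 * q) = 2 * a := by
    rw [show 2 * q = (2 * a) ^ 2 by rw [mul_pow, ha2]; ring, Real.sqrt_sq (by positivity)]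
  set κ := ((d : ℝ) - 2) / 2 with hκ
  set c := (q / 2) ^ ((2 - (d : ℝ)) / 4) with hc
  have hc0 : c ≠ 0 := (Real.rpow_pos_of_pos (by positivity) _).ne'
  set h : ℝ → ℝ := fun t => Real.exp (-(κ * t)) * Real.exp (-(2 * a) * Real.cosh t) with hh
  have himg : (fun t : ℝ => a * Real.exp t) '' univ = Ioi 0 := by
    ext w
    simp only [image_univ, mem_range, mem_Ioi]
    constructor
    · rintro ⟨t, rfl⟩; positivity
    · intro hw
      exact ⟨Real.log (w / a), by rw [Real.exp_log (by positivity)]; field_simp⟩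
  have hder : ∀ t ∈ (univ : Set ℝ),
      HasDerivWithinAt (fun t : ℝ => a * Real.exp t) (a * Real.exp t) univ t :=
    fun t _ => ((Real.hasDerivAt_exp t).const_mul a).hasDerivWithinAt
  have hinj : InjOn (fun t : ℝ => a * Real.exp t) univ := fun s _ t _ hst =>
    Real.exp_injective (mul_left_cancel₀ ha0.ne' hst)
  have hpt : ∀ t : ℝ, |a * Real.exp t| • ((a * Real.exp t) ^ (-((d : ℝ) / 2)) *
      Real.exp (-(a * Real.exp t) - q / (2 * (a * Real.exp t)))) = c * h t := fun t => by
    have he := Real.exp_pos t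
    rw [abs_of_pos (by positivity), smul_eq_mul, ← mul_assoc, hh]
    have h1 : (a * Real.exp t) * (a * Real.exp t) ^ (-((d : ℝ) / 2)) =
        c * Real.exp (-(κ * t)) := by
      have hA : 0 < a * Real.exp t := by positivity
      have h3 : (a * Real.exp t) * (a * Real.exp t) ^ (-((d : ℝ) / 2)) =
          (a * Real.exp t) ^ (1 + -((d : ℝ) / 2)) := by
        rw [Real.rpow_add hA, Real.rpow_one]
      rw [h3, Real.mul_rpow ha0.le he.le, hc, ← ha2, ← Real.rpow_natCast a 2, ← Real.rpow_mul ha0.le,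
        ← Real.exp_mul]
      congr 2
      · push_cast; ring
      · rw [hκ]; ring
    have h2 : -(a * Real.exp t) - q / (2 * (a * Real.exp t)) = -(2 * a) * Real.cosh t := by
      rw [Real.cosh_eq, Real.exp_neg, show q = 2 * a ^ 2 by rw [ha2]; ring]
      field_simp
      ring
    rw [h1, h2, mul_assoc]
  have hintg := integrableOn_rpow_mul_exp_neg_add_div d hq
  rw [← himg, integrableOn_image_iff_integrableOn_abs_deriv_smul MeasurableSet.univ hder hinj,
    integrableOn_univ] at hintg
  simp_rw [hpt] at hintg
  have hint : Integrable h := by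
    refine (hintg.const_mul c⁻¹).congr (Filter.Eventually.of_forall fun t => ?_)
    field_simp
  rw [← himg, integral_image_eq_integral_abs_deriv_smul MeasurableSet.univ hder hinj,
    setIntegral_univ]
  simp_rw [hpt]
  -- Folding the line at `0` replaces `e^{-κt}` by `e^{κt} + e^{-κt} = 2 cosh(κt)`.
  have hfold : ∫ t in Ioi (0 : ℝ), (h (-t) + h t) = 2 * besselK κ (2 * a) := by
    rw [besselK, ← integral_const_mul]
    refine integral_congr_ae (Filter.Eventually.of_forall fun t => ?_)
    simp only [hh]
    rw [Real.cosh_eq (κ * t)]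
    simp only [Real.cosh_neg, mul_neg, neg_neg]
    ring
  rw [integral_const_mul, ← intervalIntegral.integral_Iic_add_Ioi (b := 0) hint.integrableOn
    hint.integrableOn, ← neg_zero, ← integral_comp_neg_Ioi, neg_zero, ← integral_add
    hint.comp_neg.integrableOn hint.integrableOn, hfold, hz]
  ring

theorem besselK_nonneg (κ z : ℝ) : 0 ≤ besselK κ z :=
  integral_nonneg fun _ => mul_nonneg (Real.exp_pos _).le (Real.cosh_pos _).le

theorem measurable_besselK (κ : ℝ) : Measurable (besselK κ) := by
  have : StronglyMeasurable (Function.uncurry fun z t : ℝ =>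
      Real.exp (-z * Real.cosh t) * Real.cosh (κ * t)) := by
    apply Continuous.stronglyMeasurable
    unfold Function.uncurry
    fun_prop
  exact this.integral_prod_right.measurable

end Bessel

/-! ### The Laplace kernel as an exponential mixture of Gaussians. -/

section Kernel

variable {d : ℕ} {lmin lmax : ℝ} {S : Matrix (Fin d) (Fin d) ℝ}

theorem quadForm_inv_nonneg (hmax : 0 < lmax) (hmin : 0 < lmin) (hS : S ∈ scaleSet d lmin lmax)
    (y : E d) : 0 ≤ quadForm S⁻¹ y :=
  (by positivity : 0 ≤ ‖y‖ ^ 2 / lmax).trans (le_quadForm_inv hmax hmin hS y)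

theorem laplaceKernel_nonneg (hmax : 0 < lmax) (hmin : 0 < lmin) (hS : S ∈ scaleSet d lmin lmax)
    (x θ : E d) : 0 ≤ laplaceKernel d x θ S := by
  have h := quadForm_inv_nonneg hmax hmin hS (x - θ)
  have := besselK_nonneg (((d : ℝ) - 2) / 2) (Real.sqrt (2 * quadForm S⁻¹ (x - θ)))
  have := gaussDens_norm_pos hS
  unfold laplaceKernel
  positivity

theorem measurable_laplaceKernel (S : Matrix (Fin d) (Fin d) ℝ) :
    Measurable fun p : E d × E d => laplaceKernel d p.1 p.2 S := by
  have h1 : Measurable fun p : E d × E d => quadForm S⁻¹ (p.1 - p.2) :=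
    (continuous_quadForm S⁻¹).measurable.comp (measurable_fst.sub measurable_snd)
  have h2 := measurable_besselK (((d : ℝ) - 2) / 2)
  unfold laplaceKernel
  have h3 : Measurable fun p : E d × E d => besselK (((d : ℝ) - 2) / 2)
    (Real.sqrt (2 * quadForm S⁻¹ (p.1 - p.2))) := h2.comp (by fun_prop)
  fun_prop

/-- The Gaussian density at the rescaled point, with the Jacobian of the rescaling. -/
theorem rpow_mul_gaussDens (S : Matrix (Fin d) (Fin d) ℝ) {w : ℝ} (hw : 0 < w) (v : E d) :
    Real.exp (-w) * (w ^ (-((d : ℝ) / 2)) * gaussDens S ((Real.sqrt w)⁻¹ • v)) =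
      w ^ (-((d : ℝ) / 2)) * Real.exp (-w - quadForm S⁻¹ v / (2 * w)) /
        ((2 * Real.pi) ^ ((d : ℝ) / 2) * S.det ^ ((1 : ℝ) / 2)) := by
  rw [gaussDens, quadForm_smul, inv_pow, Real.sq_sqrt hw.le]
  have : -w - quadForm S⁻¹ v / (2 * w) = -w + -(w⁻¹ * quadForm S⁻¹ v) / 2 := by
    field_simp; ring
  rw [this, Real.exp_add]
  ring

theorem integrableOn_rpow_mul_gaussDens (hmax : 0 < lmax) (hmin : 0 < lmin)
    (hS : S ∈ scaleSet d lmin lmax) {v : E d} (hv : v ≠ 0) :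
    IntegrableOn (fun w : ℝ =>
      Real.exp (-w) * (w ^ (-((d : ℝ) / 2)) * gaussDens S ((Real.sqrt w)⁻¹ • v))) (Ioi 0) := by
  have hq : 0 < quadForm S⁻¹ v :=
    (by positivity : 0 < ‖v‖ ^ 2 / lmax).trans_le (le_quadForm_inv hmax hmin hS v)
  refine IntegrableOn.congr_fun ((integrableOn_rpow_mul_exp_neg_add_div d hq).div_const
    ((2 * Real.pi) ^ ((d : ℝ) / 2) * S.det ^ ((1 : ℝ) / 2))) (fun w hw => ?_)
    measurableSet_Ioi
  exact (rpow_mul_gaussDens S hw v).symm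

/-- The Laplace kernel is an exponential mixture of Gaussian densities. -/
theorem laplaceKernel_eq_integral (hmax : 0 < lmax) (hmin : 0 < lmin)
    (hS : S ∈ scaleSet d lmin lmax) {x θ : E d} (hx : x ≠ θ) :
    laplaceKernel d x θ S = ∫ w in Ioi (0 : ℝ),
      Real.exp (-w) * (w ^ (-((d : ℝ) / 2)) * gaussDens S ((Real.sqrt w)⁻¹ • (x - θ))) := by
  have hv : x - θ ≠ 0 := sub_ne_zero.2 hx
  have hq : 0 < quadForm S⁻¹ (x - θ) :=
    (by positivity : 0 < ‖x - θ‖ ^ 2 / lmax).trans_le (le_quadForm_inv hmax hmin hS _)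
  rw [setIntegral_congr_fun measurableSet_Ioi fun w hw => rpow_mul_gaussDens S hw (x - θ),
    integral_div, integral_rpow_mul_exp_neg_add_div d hq]
  rfl

theorem lintegral_comp_add_smul (F : E d → ENNReal) (hF : Measurable F) (θ : E d) {r : ℝ}
    (hr : 0 < r) :
    ∫⁻ y, F (θ + r • y) = ENNReal.ofReal ((r ^ d)⁻¹) * ∫⁻ x, F x := by
  have h1 : ∫⁻ y, F (θ + r • y) = ∫⁻ z, F (θ + z) ∂(Measure.map (r • ·) volume) := by
    rw [lintegral_map (by fun_prop) (by fun_prop)]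
  rw [h1, Measure.map_addHaar_smul _ hr.ne', lintegral_smul_measure, lintegral_add_left_eq_self,
    finrank_euclideanSpace, Fintype.card_fin, abs_of_pos (by positivity), smul_eq_mul]

/-- Tonelli for the mixture representation, after the change of variables `x = θ + √w y`. Working in
`ENNReal` requires no integrability, so the total mass and the integrability of the kernel can be
deduced from it. -/
theorem lintegral_laplaceKernel_mul (hmax : 0 < lmax) (hmin : 0 < lmin) (hd : 1 ≤ d)
    (hS : S ∈ scaleSet d lmin lmax) (θ : E d) {H : E d → ENNReal} (hH : Measurable H) :
    ∫⁻ x, ENNReal.ofReal (laplaceKernel d x θ S) * H x =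
      ∫⁻ w in Ioi (0 : ℝ), ENNReal.ofReal (Real.exp (-w)) *
        ∫⁻ y, ENNReal.ofReal (gaussDens S y) * H (θ + Real.sqrt w • y) := by
  have hgm : Measurable (gaussDens S) := (continuous_gaussDens S).measurable
  have h1 : ∀ w ∈ Ioi (0 : ℝ), ENNReal.ofReal (Real.exp (-w)) *
        ∫⁻ y, ENNReal.ofReal (gaussDens S y) * H (θ + Real.sqrt w • y) =
      ∫⁻ x, ENNReal.ofReal (Real.exp (-w) *
        (w ^ (-((d : ℝ) / 2)) * gaussDens S ((Real.sqrt w)⁻¹ • (x - θ)))) * H x := by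
    intro w hw
    have hw : 0 < w := hw
    have hs : 0 < Real.sqrt w := Real.sqrt_pos.2 hw
    have h2 := lintegral_comp_add_smul
      (fun x => ENNReal.ofReal (gaussDens S ((Real.sqrt w)⁻¹ • (x - θ))) * H x)
      (by fun_prop) θ hs
    simp only [add_sub_cancel_left, inv_smul_smul₀ hs.ne'] at h2
    have h3 : ((Real.sqrt w) ^ d)⁻¹ = w ^ (-((d : ℝ) / 2)) := by
      rw [Real.rpow_neg hw.le, Real.sqrt_eq_rpow, ← Real.rpow_natCast, ← Real.rpow_mul hw.le]
      congr 2; ring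
    rw [h2, h3, ← mul_assoc, ← ENNReal.ofReal_mul (Real.exp_pos _).le,
      ← lintegral_const_mul _ (by fun_prop)]
    refine lintegral_congr fun x => ?_
    rw [← mul_assoc, ← ENNReal.ofReal_mul (by positivity), mul_assoc (Real.exp (-w))]
  -- As `d ≥ 1`, Lebesgue measure has no atoms, so the point `x = θ`, where the representation is
  -- not available, can be discarded.
  have : Nontrivial (E d) := by
    have : Nonempty (Fin d) := ⟨⟨0, hd⟩⟩
    infer_instance
  rw [setLIntegral_congr_fun measurableSet_Ioi h1, lintegral_lintegral_swap
    (by unfold Function.uncurry; exact Measurable.aemeasurable (by fun_prop))]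
  refine lintegral_congr_ae ?_
  filter_upwards [(measure_singleton θ : volume {θ} = 0) |> compl_mem_ae_iff.2] with x hx
  have hx : x ≠ θ := hx
  rw [lintegral_mul_const _ (by fun_prop), laplaceKernel_eq_integral hmax hmin hS hx,
    ofReal_integral_eq_lintegral_ofReal
      (integrableOn_rpow_mul_gaussDens hmax hmin hS (sub_ne_zero.2 hx))]
  refine (ae_restrict_iff' measurableSet_Ioi).2 (Filter.Eventually.of_forall fun w hw => ?_)
  have hw : 0 < w := hw
  have := gaussDens_nonneg hS ((Real.sqrt w)⁻¹ • (x - θ))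
  simp only [Pi.zero_apply]
  positivity

end Kernel

/-! ### The kernel as fundamental solution of `T_S`, and mixtures. -/

section Inversion

variable {d : ℕ} {lmin lmax : ℝ} {S : Matrix (Fin d) (Fin d) ℝ}

theorem lintegral_ofReal_gaussDens (hmax : 0 < lmax) (hmin : 0 < lmin)
    (hS : S ∈ scaleSet d lmin lmax) : ∫⁻ y, ENNReal.ofReal (gaussDens S y) = 1 := by
  rw [← ofReal_integral_eq_lintegral_ofReal (integrable_gaussDens hmax hmin hS)
    (Filter.Eventually.of_forall (gaussDens_nonneg hS)), integral_gaussDens hS, ENNReal.ofReal_one]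

theorem lintegral_laplaceKernel (hmax : 0 < lmax) (hmin : 0 < lmin) (hd : 1 ≤ d)
    (hS : S ∈ scaleSet d lmin lmax) (θ : E d) :
    ∫⁻ x, ENNReal.ofReal (laplaceKernel d x θ S) = 1 := by
  have h := lintegral_laplaceKernel_mul hmax hmin hd hS θ (H := fun _ => 1) measurable_const
  simp only [mul_one, lintegral_ofReal_gaussDens hmax hmin hS] at h
  rw [h, ← ofReal_integral_eq_lintegral_ofReal (integrableOn_exp_neg_Ioi 0)
    (Filter.Eventually.of_forall fun w => (Real.exp_pos _).le), integral_exp_neg_Ioi_zero,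
    ENNReal.ofReal_one]

theorem measurable_laplaceKernel_left (S : Matrix (Fin d) (Fin d) ℝ) (θ : E d) :
    Measurable fun x : E d => laplaceKernel d x θ S := by
  have h : Measurable fun x : E d => (x, θ) := by fun_prop
  have h2 := (measurable_laplaceKernel S).comp h
  simpa only [Function.comp_def] using h2

theorem integrable_laplaceKernel (hmax : 0 < lmax) (hmin : 0 < lmin) (hd : 1 ≤ d)
    (hS : S ∈ scaleSet d lmin lmax) (θ : E d) :
    Integrable fun x => laplaceKernel d x θ S := by
  refine ⟨(measurable_laplaceKernel_left S θ).aestronglyMeasurable, ?_⟩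
  rw [hasFiniteIntegral_iff_ofReal
    (Filter.Eventually.of_forall fun x => laplaceKernel_nonneg hmax hmin hS x θ),
    lintegral_laplaceKernel hmax hmin hd hS θ]
  exact ENNReal.one_lt_top

theorem integral_laplaceKernel (hmax : 0 < lmax) (hmin : 0 < lmin) (hd : 1 ≤ d)
    (hS : S ∈ scaleSet d lmin lmax) (θ : E d) :
    ∫ x, laplaceKernel d x θ S = 1 := by
  rw [integral_eq_lintegral_of_nonneg_ae
    (Filter.Eventually.of_forall fun x => laplaceKernel_nonneg hmax hmin hS x θ)
    (measurable_laplaceKernel_left S θ).aestronglyMeasurable,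
    lintegral_laplaceKernel hmax hmin hd hS θ, ENNReal.toReal_one]

/-- The law with the Laplace density is that of `θ + √w y` with `w` exponential and `y` Gaussian. -/
theorem withDensity_laplaceKernel (hmax : 0 < lmax) (hmin : 0 < lmin) (hd : 1 ≤ d)
    (hS : S ∈ scaleSet d lmin lmax) (θ : E d) :
    (volume : Measure (E d)).withDensity (fun x => ENNReal.ofReal (laplaceKernel d x θ S)) =
      Measure.map (fun p : ℝ × E d => θ + Real.sqrt p.1 • p.2)
        (((volume.restrict (Ioi 0)).withDensity fun w => ENNReal.ofReal (Real.exp (-w))).prod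
          (volume.withDensity fun y => ENNReal.ofReal (gaussDens S y))) := by
  have hgm : Measurable (gaussDens S) := (continuous_gaussDens S).measurable
  have hkm := measurable_laplaceKernel_left S θ
  refine Measure.ext_of_lintegral _ fun H hH => ?_
  have hHm : Measurable fun p : ℝ × E d => H (θ + Real.sqrt p.1 • p.2) := by fun_prop
  rw [lintegral_withDensity_eq_lintegral_mul _ (by fun_prop) hH, lintegral_map hH (by fun_prop),
    lintegral_prod _ hHm.aemeasurable,
    lintegral_withDensity_eq_lintegral_mul _ (by fun_prop) hHm.lintegral_prod_right']
  simp only [Pi.mul_apply]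
  rw [lintegral_laplaceKernel_mul hmax hmin hd hS θ hH]
  refine lintegral_congr fun w => ?_
  rw [lintegral_withDensity_eq_lintegral_mul _ (by fun_prop) (by fun_prop)]
  rfl

theorem integral_withDensity_ofReal {X : Type*} [MeasurableSpace X] {μ : Measure X} {f : X → ℝ}
    (hf : Measurable f) (hf0 : ∀ x, 0 ≤ f x) (g : X → ℝ) :
    ∫ x, g x ∂(μ.withDensity fun x => ENNReal.ofReal (f x)) = ∫ x, f x * g x ∂μ := by
  rw [integral_withDensity_eq_integral_toReal_smul (by fun_prop)
    (Filter.Eventually.of_forall fun _ => ENNReal.ofReal_lt_top)]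
  simp [ENNReal.toReal_ofReal (hf0 _)]

theorem integral_laplaceKernel_mul (hmax : 0 < lmax) (hmin : 0 < lmin) (hd : 1 ≤ d)
    (hS : S ∈ scaleSet d lmin lmax) (θ : E d) {H : E d → ℝ} (hH : Measurable H) {M : ℝ}
    (hM : ∀ x, |H x| ≤ M) :
    ∫ x, laplaceKernel d x θ S * H x =
      ∫ w in Ioi (0 : ℝ), Real.exp (-w) * ∫ y, H (θ + Real.sqrt w • y) * gaussDens S y := by
  have hgm : Measurable (gaussDens S) := (continuous_gaussDens S).measurable
  rw [← integral_withDensity_ofReal (measurable_laplaceKernel_left S θ)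
    (fun x => laplaceKernel_nonneg hmax hmin hS x θ), withDensity_laplaceKernel hmax hmin hd hS θ,
    integral_map (by fun_prop) hH.aestronglyMeasurable]
  have : IsFiniteMeasure ((volume.restrict (Ioi (0 : ℝ))).withDensity
      fun w => ENNReal.ofReal (Real.exp (-w))) :=
    isFiniteMeasure_withDensity_ofReal (integrableOn_exp_neg_Ioi 0).2
  have : IsFiniteMeasure ((volume : Measure (E d)).withDensity
      fun y => ENNReal.ofReal (gaussDens S y)) :=
    isFiniteMeasure_withDensity_ofReal (integrable_gaussDens hmax hmin hS).2
  rw [integral_prod, integral_withDensity_ofReal (by fun_prop) (fun w => (Real.exp_pos _).le)]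
  · refine integral_congr_ae (Filter.Eventually.of_forall fun w => ?_)
    simp only
    rw [integral_withDensity_ofReal hgm (gaussDens_nonneg hS)]
    simp_rw [mul_comm (gaussDens S _)]
  · exact (integrable_const M).mono' (Measurable.aestronglyMeasurable (by fun_prop))
      (Filter.Eventually.of_forall fun p => hM _)

/-- `T_S f(· ∣ θ, S) = δ_θ`, tested against bounded functions with bounded derivatives. -/
theorem integral_laplaceKernel_mul_laplaceOp (hmax : 0 < lmax) (hmin : 0 < lmin) (hd : 1 ≤ d)
    (hS : S ∈ scaleSet d lmin lmax) (θ : E d) {φ : E d → ℝ} (hφ : BoundedC2 φ) :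
    ∫ x, laplaceKernel d x θ S * laplaceOp S φ x = φ θ := by
  obtain ⟨M, hM⟩ := hφ.exists_abs_laplaceOp_le S
  rw [integral_laplaceKernel_mul hmax hmin hd hS θ (continuous_laplaceOp hφ.1 S).measurable hM,
    integral_exp_mul_laplaceOp hmax hmin hS hφ]

/-- Each section in `x` has mass one and `P` is finite. This justifies Fubini for mixtures. -/
theorem integrable_laplaceKernel_prod (hmax : 0 < lmax) (hmin : 0 < lmin) (hd : 1 ≤ d)
    (hS : S ∈ scaleSet d lmin lmax) (P : Measure (E d)) [IsProbabilityMeasure P] :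
    Integrable (fun p : E d × E d => laplaceKernel d p.1 p.2 S) (volume.prod P) := by
  rw [integrable_prod_iff' (measurable_laplaceKernel S).aestronglyMeasurable]
  refine ⟨Filter.Eventually.of_forall fun θ => integrable_laplaceKernel hmax hmin hd hS θ, ?_⟩
  simp_rw [Real.norm_of_nonneg (laplaceKernel_nonneg hmax hmin hS _ _),
    integral_laplaceKernel hmax hmin hd hS]
  exact integrable_const _

theorem integrable_mixtureDensity (hmax : 0 < lmax) (hmin : 0 < lmin) (hd : 1 ≤ d)
    (hS : S ∈ scaleSet d lmin lmax) (P : Measure (E d)) [IsProbabilityMeasure P] :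
    Integrable (mixtureDensity (laplaceKernel d) ⟨P, S⟩) :=
  (integrable_laplaceKernel_prod hmax hmin hd hS P).integral_prod_left

theorem mixtureDensity_nonneg (hmax : 0 < lmax) (hmin : 0 < lmin)
    (hS : S ∈ scaleSet d lmin lmax) (P : Measure (E d)) (x : E d) :
    0 ≤ mixtureDensity (laplaceKernel d) ⟨P, S⟩ x :=
  integral_nonneg fun θ => laplaceKernel_nonneg hmax hmin hS x θ

theorem integral_mixtureDensity_mul (hmax : 0 < lmax) (hmin : 0 < lmin) (hd : 1 ≤ d)
    (hS : S ∈ scaleSet d lmin lmax) (P : Measure (E d)) [IsProbabilityMeasure P]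
    {H : E d → ℝ} (hH : Measurable H) {M : ℝ} (hM : ∀ x, |H x| ≤ M) :
    ∫ x, mixtureDensity (laplaceKernel d) ⟨P, S⟩ x * H x =
      ∫ θ, (∫ x, laplaceKernel d x θ S * H x) ∂P := by
  have hint : Integrable (fun p : E d × E d => laplaceKernel d p.1 p.2 S * H p.1)
      (volume.prod P) :=
    (integrable_laplaceKernel_prod hmax hmin hd hS P).mul_bdd (c := M)
      (Measurable.aestronglyMeasurable (by fun_prop)) (Filter.Eventually.of_forall fun p => hM _)
  simp only [mixtureDensity]
  simp_rw [← integral_mul_const]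
  exact integral_integral_swap (f := fun x θ => laplaceKernel d x θ S * H x) hint

/-- `T_S p_G = P`, tested against bounded functions with bounded derivatives. -/
theorem integral_mixtureDensity_mul_laplaceOp (hmax : 0 < lmax) (hmin : 0 < lmin) (hd : 1 ≤ d)
    (hS : S ∈ scaleSet d lmin lmax) (P : Measure (E d)) [IsProbabilityMeasure P]
    {φ : E d → ℝ} (hφ : BoundedC2 φ) :
    ∫ x, mixtureDensity (laplaceKernel d) ⟨P, S⟩ x * laplaceOp S φ x = ∫ θ, φ θ ∂P := by
  obtain ⟨M, hM⟩ := hφ.exists_abs_laplaceOp_le S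
  rw [integral_mixtureDensity_mul hmax hmin hd hS P (continuous_laplaceOp hφ.1 S).measurable hM]
  exact integral_congr_ae (Filter.Eventually.of_forall fun θ =>
    integral_laplaceKernel_mul_laplaceOp hmax hmin hd hS θ hφ)

theorem integrable_mixtureDensity_mul (hmax : 0 < lmax) (hmin : 0 < lmin) (hd : 1 ≤ d)
    (hS : S ∈ scaleSet d lmin lmax) (P : Measure (E d)) [IsProbabilityMeasure P]
    {H : E d → ℝ} (hH : Measurable H) {M : ℝ} (hM : ∀ x, |H x| ≤ M) :
    Integrable fun x => mixtureDensity (laplaceKernel d) ⟨P, S⟩ x * H x :=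
  (integrable_mixtureDensity hmax hmin hd hS P).mul_bdd (c := M) hH.aestronglyMeasurable
    (Filter.Eventually.of_forall hM)

end Inversion

/-! ### Ridge functions, the characteristic function, smoothness and regularity. -/

section PlaneWave

variable {d : ℕ} {lmin lmax : ℝ} {S S' : Matrix (Fin d) (Fin d) ℝ}

theorem pderiv_comp_inner {g : ℝ → ℝ} (hg : Differentiable ℝ g) (v : E d) (k : Fin d) :
    pderiv k (fun x => g (inner ℝ v x)) = fun x => v k * deriv g (inner ℝ v x) := by
  ext x
  have h1 : HasFDerivAt (fun x : E d => inner ℝ v x) (innerSL ℝ v) x :=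
    (innerSL ℝ v).hasFDerivAt
  have h2 := (hg (inner ℝ v x)).hasDerivAt.comp_hasFDerivAt x h1
  have h3 : fderiv ℝ (fun x : E d => g (inner ℝ v x)) x = _ := h2.fderiv
  simp [pderiv, h3, EuclideanSpace.inner_single_right, mul_comm]

theorem pderiv_const_mul {f : E d → ℝ} (hf : Differentiable ℝ f) (c : ℝ) (k : Fin d) :
    pderiv k (fun x => c * f x) = fun x => c * pderiv k f x := by
  ext x
  simp [pderiv, fderiv_const_mul (hf x)]

theorem pderiv_pderiv_comp_inner {g : ℝ → ℝ} (hg : ContDiff ℝ 2 g) (v : E d) (j k : Fin d) :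
    pderiv j (pderiv k fun x => g (inner ℝ v x)) =
      fun x => v k * (v j * deriv (deriv g) (inner ℝ v x)) := by
  have hg1 : ContDiff ℝ 1 (deriv g) := hg.iterate_deriv' 1 1
  have hg1' := hg1.differentiable one_ne_zero
  rw [pderiv_comp_inner (hg.differentiable (by norm_num)),
    pderiv_const_mul (f := fun x => deriv g (inner ℝ v x)) (hg1'.comp (innerSL ℝ v).differentiable),
    pderiv_comp_inner hg1']

theorem boundedC2_comp_inner {g : ℝ → ℝ} (hg : ContDiff ℝ 2 g) {M : ℝ} (h0 : ∀ t, |g t| ≤ M)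
    (h1 : ∀ t, |deriv g t| ≤ M) (h2 : ∀ t, |deriv (deriv g) t| ≤ M) (v : E d) :
    BoundedC2 fun x => g (inner ℝ v x) := by
  have hM : 0 ≤ M := (abs_nonneg _).trans (h0 0)
  have hv : ∀ k, |v k| ≤ ‖v‖ := fun k => PiLp.norm_apply_le v k
  have hn := norm_nonneg v
  refine ⟨hg.comp (contDiff_const.inner ℝ contDiff_id), M + ‖v‖ * M + ‖v‖ * (‖v‖ * M),
    fun x => ⟨?_, fun k => ?_, fun j k => ?_⟩⟩
  · have := h0 (inner ℝ v x)
    have : 0 ≤ ‖v‖ * M + ‖v‖ * (‖v‖ * M) := by positivity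
    linarith
  · rw [pderiv_comp_inner (hg.differentiable (by norm_num)), abs_mul]
    have := mul_le_mul (hv k) (h1 (inner ℝ v x)) (abs_nonneg _) hn
    have : 0 ≤ ‖v‖ * (‖v‖ * M) := by positivity
    linarith
  · rw [pderiv_pderiv_comp_inner hg, abs_mul, abs_mul]
    have := mul_le_mul (hv j) (h2 (inner ℝ v x)) (abs_nonneg _) hn
    have := mul_le_mul (hv k) this (by positivity) hn
    have : 0 ≤ ‖v‖ * M := by positivity
    linarith

/-- On functions of `⟨v, x⟩` alone, `T_S` reduces to the one-dimensional operator `1 - (vᵀSv/2)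
d²/dt²`. Both the plane waves and the bumps of the scale bound are of this type. -/
theorem laplaceOp_comp_inner {g : ℝ → ℝ} (hg : ContDiff ℝ 2 g) (S : Matrix (Fin d) (Fin d) ℝ)
    (v x : E d) :
    laplaceOp S (fun x => g (inner ℝ v x)) x =
      g (inner ℝ v x) - 1 / 2 * quadForm S v * deriv (deriv g) (inner ℝ v x) := by
  simp only [laplaceOp, pderiv_pderiv_comp_inner hg]
  rw [quadForm_eq_sum, mul_assoc (1 / 2 : ℝ), Finset.sum_mul]
  congr 2
  refine Finset.sum_congr rfl fun j _ => ?_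
  rw [Finset.sum_mul]
  exact Finset.sum_congr rfl fun k _ => by ring

/-- The functions `cos⟨ξ, x⟩` and `sin⟨ξ, x⟩` are eigenfunctions of `T_S` with eigenvalue `1 +
ξᵀSξ/2`. Testing `T_S f(· ∣ 0, S) = δ_0` against them gives `1` and `0` divided by that eigenvalue.
-/
theorem kernelCharFun_laplaceKernel (hmax : 0 < lmax) (hmin : 0 < lmin) (hd : 1 ≤ d)
    (hS : S ∈ scaleSet d lmin lmax) (ξ : E d) :
    kernelCharFun (laplaceKernel d) S ξ = (((1 + quadForm S ξ / 2)⁻¹ : ℝ) : ℂ) := by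
  have hq : 0 ≤ quadForm S ξ :=
    (by positivity : 0 ≤ lmin * ‖ξ‖ ^ 2).trans (le_quadForm_of_mem_scaleSet hS ξ)
  have hd2 : ∀ t, deriv (deriv Real.cos) t = -Real.cos t := fun t => by simp
  have hd2' : ∀ t, deriv (deriv Real.sin) t = -Real.sin t := fun t => by simp
  have hcos : ∫ x, laplaceKernel d x 0 S * Real.cos (inner ℝ ξ x) = (1 + quadForm S ξ / 2)⁻¹ := by
    have h := integral_laplaceKernel_mul_laplaceOp hmax hmin hd hS 0
      (boundedC2_comp_inner (M := 1) Real.contDiff_cos Real.abs_cos_le_one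
        (fun t => by simpa using Real.abs_sin_le_one t)
        (fun t => by rw [hd2, abs_neg]; exact Real.abs_cos_le_one t) ξ)
    have h2 : ∀ x, laplaceKernel d x 0 S * laplaceOp S (fun x => Real.cos (inner ℝ ξ x)) x =
        (1 + quadForm S ξ / 2) * (laplaceKernel d x 0 S * Real.cos (inner ℝ ξ x)) := fun x => by
      rw [laplaceOp_comp_inner Real.contDiff_cos, hd2]; ring
    simp_rw [h2] at h
    rw [integral_const_mul, inner_zero_right, Real.cos_zero] at h
    exact eq_inv_of_mul_eq_one_right h
  have hsin : ∫ x, laplaceKernel d x 0 S * Real.sin (inner ℝ ξ x) = 0 := by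
    have h := integral_laplaceKernel_mul_laplaceOp hmax hmin hd hS 0
      (boundedC2_comp_inner (M := 1) Real.contDiff_sin Real.abs_sin_le_one
        (fun t => by simpa using Real.abs_cos_le_one t)
        (fun t => by rw [hd2', abs_neg]; exact Real.abs_sin_le_one t) ξ)
    have h2 : ∀ x, laplaceKernel d x 0 S * laplaceOp S (fun x => Real.sin (inner ℝ ξ x)) x =
        (1 + quadForm S ξ / 2) * (laplaceKernel d x 0 S * Real.sin (inner ℝ ξ x)) := fun x => by
      rw [laplaceOp_comp_inner Real.contDiff_sin, hd2']; ring
    simp_rw [h2] at h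
    rw [integral_const_mul, inner_zero_right, Real.sin_zero] at h
    exact (mul_eq_zero.1 h).resolve_left (by positivity)
  have hint := integrable_laplaceKernel hmax hmin hd hS 0
  have hc : Integrable fun x => laplaceKernel d x 0 S * Real.cos (inner ℝ ξ x) :=
    hint.mul_bdd (c := 1) (Continuous.aestronglyMeasurable (by fun_prop))
      (Filter.Eventually.of_forall fun x => Real.abs_cos_le_one _)
  have hs : Integrable fun x => laplaceKernel d x 0 S * Real.sin (inner ℝ ξ x) :=
    hint.mul_bdd (c := 1) (Continuous.aestronglyMeasurable (by fun_prop))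
      (Filter.Eventually.of_forall fun x => Real.abs_sin_le_one _)
  have hsplit : ∀ x : E d, Complex.exp (Complex.I * (inner ℝ ξ x : ℝ)) * (laplaceKernel d x 0 S : ℂ) =
      ((laplaceKernel d x 0 S * Real.cos (inner ℝ ξ x) : ℝ) : ℂ) +
        Complex.I * ((laplaceKernel d x 0 S * Real.sin (inner ℝ ξ x) : ℝ) : ℂ) := fun x => by
    rw [mul_comm Complex.I, Complex.exp_mul_I]
    push_cast
    ring
  rw [kernelCharFun]
  simp_rw [hsplit]
  rw [integral_add hc.ofReal (hs.ofReal.const_mul _), integral_const_mul,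
    integral_complex_ofReal, integral_complex_ofReal, hcos, hsin]
  simp

theorem ordinarySmooth_laplaceKernel (hmin : 0 < lmin) (hmax : 0 < lmax) (hd : 1 ≤ d) :
    OrdinarySmooth (laplaceKernel d) lmin lmax 2 := by
  -- The constants come from `1 + q/2 ≤ (1 + lmax)(1 + ‖ξ‖²)` and `1 + ‖ξ‖² ≤ (1 + 2/lmin)(1 +
  -- q/2)`, where `q = ξᵀSξ`.
  refine ⟨by norm_num, (1 + lmax)⁻¹, by positivity, 1 + 2 / lmin, by positivity, fun ξ S hS => ?_⟩
  have h1 := le_quadForm_of_mem_scaleSet hS ξ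
  have h2 := quadForm_le_of_mem_scaleSet hS ξ
  have hn : 0 ≤ ‖ξ‖ ^ 2 := by positivity
  have hq : 0 ≤ quadForm S ξ := (by positivity : 0 ≤ lmin * ‖ξ‖ ^ 2).trans h1
  rw [kernelCharFun_laplaceKernel hmax hmin hd hS, Complex.norm_real,
    Real.norm_of_nonneg (by positivity), Real.rpow_two]
  constructor
  · rw [← mul_inv]
    apply inv_anti₀ (by positivity)
    nlinarith
  · rw [← div_eq_mul_inv, inv_eq_one_div, div_le_div_iff₀ (by positivity) (by positivity)]
    have : 2 / lmin * (lmin * ‖ξ‖ ^ 2) = 2 * ‖ξ‖ ^ 2 := by field_simp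
    have h3 : 2 / lmin * (lmin * ‖ξ‖ ^ 2) ≤ 2 / lmin * quadForm S ξ := by gcongr
    have : 0 ≤ 2 / lmin := by positivity
    nlinarith

/-- The difference of the two reciprocals is `ξᵀ(S - S')ξ / 2` times the product of the
characteristic functions. Both lie in `(0, 1]`, so the product is at most their maximum. -/
theorem scaleRegularity_laplaceKernel (hmin : 0 < lmin) (hmax : 0 < lmax) (hd : 1 ≤ d) :
    ScaleRegularity (laplaceKernel d) lmin lmax (fun t => t) 2 := by
  refine ⟨by norm_num, ⟨fun x hx => hx, fun x _ y _ h => h⟩, 1 / 2, by norm_num,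
    fun ξ S hS S' hS' => ?_⟩
  have h1 := le_quadForm_of_mem_scaleSet hS ξ
  have h1' := le_quadForm_of_mem_scaleSet hS' ξ
  have hn : 0 ≤ lmin * ‖ξ‖ ^ 2 := by positivity
  have hq : 0 ≤ quadForm S ξ := hn.trans h1
  have hq' : 0 ≤ quadForm S' ξ := hn.trans h1'
  rw [kernelCharFun_laplaceKernel hmax hmin hd hS, kernelCharFun_laplaceKernel hmax hmin hd hS',
    ← Complex.ofReal_sub, Complex.norm_real, Complex.norm_real, Complex.norm_real, Real.rpow_two,
    Real.norm_of_nonneg (by positivity : 0 ≤ (1 + quadForm S ξ / 2)⁻¹),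
    Real.norm_of_nonneg (by positivity : 0 ≤ (1 + quadForm S' ξ / 2)⁻¹), Real.norm_eq_abs]
  have h2 : (1 + quadForm S' ξ / 2)⁻¹ - (1 + quadForm S ξ / 2)⁻¹ =
      1 / 2 * quadForm (S - S') ξ * ((1 + quadForm S' ξ / 2)⁻¹ * (1 + quadForm S ξ / 2)⁻¹) := by
    rw [quadForm_sub]; field_simp; ring
  rw [h2, abs_mul, abs_mul, abs_of_pos (by norm_num : (0 : ℝ) < 1 / 2),
    abs_of_nonneg (by positivity : 0 ≤ (1 + quadForm S' ξ / 2)⁻¹ * (1 + quadForm S ξ / 2)⁻¹)]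
  have h3 := abs_quadForm_le (S - S') ξ
  have h4 : (1 + quadForm S ξ / 2)⁻¹ ≤ 1 := inv_le_one_of_one_le₀ (by linarith)
  have h5 : (1 + quadForm S' ξ / 2)⁻¹ * (1 + quadForm S ξ / 2)⁻¹ ≤
      max (1 + quadForm S' ξ / 2)⁻¹ (1 + quadForm S ξ / 2)⁻¹ :=
    (mul_le_of_le_one_right (by positivity) h4).trans (le_max_left _ _)
  have := opNorm_nonneg (S - S')
  calc _ ≤ 1 / 2 * (opNorm (S - S') * ‖ξ‖ ^ 2) *
        max (1 + quadForm S' ξ / 2)⁻¹ (1 + quadForm S ξ / 2)⁻¹ := by gcongr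
    _ = _ := by ring

end PlaneWave

/-! ### Lower bound for the scale in `L¹`. -/

section ScaleBound

variable {d : ℕ} {lmin lmax R : ℝ} {S S' : Matrix (Fin d) (Fin d) ℝ}

theorem ae_norm_le_of_mem_mixingClass {X : Set (E d)} (hX : X ⊆ Metric.closedBall 0 R)
    {G : Mixing d} (hG : G ∈ mixingClass X lmin lmax) : ∀ᵐ θ ∂G.P, ‖θ‖ ≤ R := by
  filter_upwards [Measure.support_mem_ae (μ := G.P)] with θ hθ
  simpa using hX (hG.2.1 hθ)

/-- The constant of the lower bound `le_laplaceKernel`. -/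
def densityBound (d : ℕ) (lmin lmax D : ℝ) : ℝ :=
  Real.exp (-2) * (2 ^ (-((d : ℝ) / 2)) * (Real.exp (-(D ^ 2 / lmin) / 2) /
    ((2 * Real.pi) ^ ((d : ℝ) / 2) * (lmax ^ d) ^ ((1 : ℝ) / 2))))

theorem densityBound_pos (hmax : 0 < lmax) (D : ℝ) : 0 < densityBound d lmin lmax D := by
  have := Real.pi_pos
  unfold densityBound
  positivity

/-- In the mixture representation keep only the times `w ∈ (1, 2]`, an interval of length one on
which every factor has an explicit positive lower bound. -/
theorem le_laplaceKernel (hmax : 0 < lmax) (hmin : 0 < lmin) (hS : S ∈ scaleSet d lmin lmax)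
    {x θ : E d} (hx : x ≠ θ) {D : ℝ} (hD : ‖x - θ‖ ≤ D) :
    densityBound d lmin lmax D ≤ laplaceKernel d x θ S := by
  rw [laplaceKernel_eq_integral hmax hmin hS hx]
  have hint := integrableOn_rpow_mul_gaussDens hmax hmin hS (sub_ne_zero.2 hx)
  have hsub : Ioc (1 : ℝ) 2 ⊆ Ioi 0 := fun w hw => lt_trans one_pos hw.1
  have hdet := det_pos_of_mem_scaleSet hS
  have hpi := Real.pi_pos
  have h1 : ∫ w in Ioc (1 : ℝ) 2, densityBound d lmin lmax D ≤ ∫ w in Ioc (1 : ℝ) 2,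
      Real.exp (-w) * (w ^ (-((d : ℝ) / 2)) * gaussDens S ((Real.sqrt w)⁻¹ • (x - θ))) := by
    refine setIntegral_mono_on (by simp) (hint.mono_set hsub) measurableSet_Ioc fun w hw => ?_
    have hw0 : 0 < w := hsub hw
    have hq : quadForm S⁻¹ ((Real.sqrt w)⁻¹ • (x - θ)) ≤ D ^ 2 / lmin := by
      rw [quadForm_smul, inv_pow, Real.sq_sqrt hw0.le]
      have h2 := quadForm_inv_le hmin hS (x - θ)
      have h3 : ‖x - θ‖ ^ 2 / lmin ≤ D ^ 2 / lmin := by gcongr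
      have h4 : w⁻¹ ≤ 1 := inv_le_one_of_one_le₀ hw.1.le
      have h5 := quadForm_inv_nonneg hmax hmin hS (x - θ)
      nlinarith
    have hr : (2 : ℝ) ^ (-((d : ℝ) / 2)) ≤ w ^ (-((d : ℝ) / 2)) :=
      Real.rpow_le_rpow_of_nonpos hw0 hw.2 (neg_nonpos.2 (by positivity))
    have hr0 : (0 : ℝ) ≤ w ^ (-((d : ℝ) / 2)) := by positivity
    unfold densityBound gaussDens
    have hr1 : (0 : ℝ) ≤ (2 : ℝ) ^ (-((d : ℝ) / 2)) := by positivity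
    generalize (2 : ℝ) ^ (-((d : ℝ) / 2)) = r at hr hr1
    generalize w ^ (-((d : ℝ) / 2)) = r' at hr hr0
    gcongr
    · exact hw.2
    · exact det_le_of_mem_scaleSet hmin hS
  have h2 : ∫ w in Ioc (1 : ℝ) 2, densityBound d lmin lmax D = densityBound d lmin lmax D := by
    rw [setIntegral_const, measureReal_def, Real.volume_Ioc]; norm_num
  rw [h2] at h1
  refine h1.trans (setIntegral_mono_set hint ?_ hsub.eventuallyLE)
  refine (ae_restrict_iff' measurableSet_Ioi).2 (Filter.Eventually.of_forall fun w hw => ?_)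
  have hw : 0 < w := hw
  have := gaussDens_nonneg hS ((Real.sqrt w)⁻¹ • (x - θ))
  simp only [Pi.zero_apply]
  positivity

theorem abs_integral_sub_mul_le {p p' H : E d → ℝ} (hp : Integrable p) (hp' : Integrable p')
    {M : ℝ} (hM : ∀ x, |H x| ≤ M) : |∫ x, (p x - p' x) * H x| ≤ M * l1Dist p p' := by
  rw [l1Dist, ← integral_const_mul, ← Real.norm_eq_abs]
  refine norm_integral_le_of_norm_le ((hp.sub hp').abs.const_mul M)
    (Filter.Eventually.of_forall fun x => ?_)
  rw [norm_mul, mul_comm, Real.norm_eq_abs, Real.norm_eq_abs]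
  exact mul_le_mul_of_nonneg_right (hM x) (abs_nonneg _)

theorem scaleLowerBound_laplaceKernel (hmin : 0 < lmin) (hmax : 0 < lmax) (hd : 1 ≤ d)
    (hR : 0 < R) : ScaleLowerBound (laplaceKernel d) R lmin lmax (fun t => t) := by
  refine ⟨⟨fun x hx => hx, fun x _ y _ h => h⟩, ?_⟩
  -- The bump is supported in `[R + 1, R + 3]`, so `ψ(⟨v, ·⟩)` vanishes on the ball of radius `R`
  -- for every unit `v`. It equals one within `1/2` of `R + 2`.
  let ψ : ContDiffBump (R + 2) := ⟨1 / 2, 1, by norm_num, by norm_num⟩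
  have hψ : ContDiff ℝ 2 ψ := ψ.contDiff
  have hψc : HasCompactSupport ψ := ψ.hasCompactSupport
  have hψ1 : ContDiff ℝ 1 (deriv ψ) := hψ.iterate_deriv' 1 1
  have hψ2 : Continuous (deriv (deriv ψ)) := hψ1.continuous_deriv le_rfl
  obtain ⟨M0, hM0⟩ := hψ.continuous.bounded_above_of_compact_support hψc
  obtain ⟨M1, hM1⟩ := hψ1.continuous.bounded_above_of_compact_support hψc.deriv
  obtain ⟨M2, hM2⟩ := hψ2.bounded_above_of_compact_support hψc.deriv.deriv
  set M := max M0 (max M1 M2)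
  have hM0' : ∀ t, |ψ t| ≤ M := fun t => (hM0 t).trans (le_max_left _ _)
  have hM1' : ∀ t, |deriv ψ t| ≤ M := fun t =>
    (hM1 t).trans ((le_max_left _ _).trans (le_max_right _ _))
  have hM2' : ∀ t, |deriv (deriv ψ) t| ≤ M := fun t =>
    (hM2 t).trans ((le_max_right _ _).trans (le_max_right _ _))
  have hMnn : 0 ≤ M := (abs_nonneg _).trans (hM0' 0)
  -- Lower bound for `∫ p' φ`: on the ball of radius `1/2` about `(R + 2) v` one has `φ = 1`, and
  -- its points lie within `(R + 3) + R` of every location.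
  set m := densityBound d lmin lmax (2 * R + 3) *
    (volume : Measure (E d)).real (Metric.ball (0 : E d) (1 / 2)) with hm
  have hm0 : 0 < m := mul_pos (densityBound_pos hmax _)
    (ENNReal.toReal_pos (Metric.measure_ball_pos volume _ (by norm_num)).ne' measure_ball_lt_top.ne)
  set K := M + 1 / 2 * lmax * M + 1 with hK
  have hK0 : 0 < K := by positivity
  refine ⟨m / (lmax * K), by positivity, fun X hXm hX G hG G' hG' => ?_⟩
  have hsupp := ae_norm_le_of_mem_mixingClass hX hG
  have hsupp' := ae_norm_le_of_mem_mixingClass hX hG'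
  obtain ⟨hP, -, hS⟩ := hG
  obtain ⟨hP', -, hS'⟩ := hG'
  obtain ⟨P, S⟩ := G
  obtain ⟨P', S'⟩ := G'
  simp only at hsupp hsupp' hP hP' hS hS' ⊢
  set p := mixtureDensity (laplaceKernel d) ⟨P, S⟩
  set p' := mixtureDensity (laplaceKernel d) ⟨P', S'⟩
  have hp : Integrable p := integrable_mixtureDensity hmax hmin hd hS P
  have hp' : Integrable p' := integrable_mixtureDensity hmax hmin hd hS' P'
  have hL0 : 0 ≤ l1Dist p p' := integral_nonneg fun x => abs_nonneg _
  suffices h : opNorm (S - S') ≤ l1Dist p p' * (lmax * K) / m by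
    rw [div_mul_eq_mul_div, div_le_iff₀ (by positivity), mul_comm m]
    rwa [le_div_iff₀ hm0] at h
  refine opNorm_le (by positivity) fun v hv => ?_
  rw [le_div_iff₀ hm0, quadForm_sub]
  have hs := quadForm_le_of_mem_scaleSet hS v
  have hs' := quadForm_le_of_mem_scaleSet hS' v
  have hs1 := le_quadForm_of_mem_scaleSet hS v
  have hs1' := le_quadForm_of_mem_scaleSet hS' v
  rw [hv, one_pow, mul_one] at hs hs' hs1 hs1'
  set s := quadForm S v
  set s' := quadForm S' v
  have hs0 : 0 < s := hmin.trans_le hs1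
  have hs0' : 0 < s' := hmin.trans_le hs1'
  have hφ : BoundedC2 fun x : E d => ψ (inner ℝ v x) := boundedC2_comp_inner hψ hM0' hM1' hM2' v
  have hle : ∀ θ : E d, inner ℝ v θ ≤ ‖θ‖ := fun θ => by
    simpa [hv] using real_inner_le_norm v θ
  have hφ0 : ∀ θ : E d, ‖θ‖ ≤ R → ψ (inner ℝ v θ) = 0 := fun θ hθ => by
    refine ψ.zero_of_le_dist ?_
    have := hle θ
    rw [Real.dist_eq, abs_of_nonpos (by linarith)]
    change (1 : ℝ) ≤ _
    linarith
  have hinv := integral_mixtureDensity_mul_laplaceOp hmax hmin hd hS P hφ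
  have hinv' := integral_mixtureDensity_mul_laplaceOp hmax hmin hd hS' P' hφ
  rw [integral_eq_zero_of_ae (hsupp.mono hφ0)] at hinv
  rw [integral_eq_zero_of_ae (hsupp'.mono hφ0)] at hinv'
  simp_rw [laplaceOp_comp_inner hψ] at hinv hinv'
  set H : E d → ℝ := fun x => ψ (inner ℝ v x) - 1 / 2 * s * deriv (deriv ψ) (inner ℝ v x) with hH
  have hHM : ∀ x, |H x| ≤ K := fun x => by
    rw [hH]
    refine (abs_sub _ _).trans ?_
    rw [abs_mul, abs_of_nonneg (by positivity : 0 ≤ 1 / 2 * s)]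
    have h1 := hM0' (inner ℝ v x)
    have h2 := mul_le_mul (by linarith : 1 / 2 * s ≤ 1 / 2 * lmax) (hM2' (inner ℝ v x))
      (abs_nonneg _) (by positivity)
    linarith
  have hψc0 : Continuous ψ := hψ.continuous
  have hHmeas : Continuous H := by rw [hH]; fun_prop
  have hi1 : Integrable fun x => p x * H x :=
    integrable_mixtureDensity_mul hmax hmin hd hS P hHmeas.measurable hHM
  have hi1' : Integrable fun x => p' x * H x :=
    integrable_mixtureDensity_mul hmax hmin hd hS' P' hHmeas.measurable hHM
  have hiψ : Integrable fun x => p' x * ψ (inner ℝ v x) :=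
    integrable_mixtureDensity_mul hmax hmin hd hS' P'
      (Continuous.measurable (by fun_prop)) fun x => hM0' _
  have hid : Integrable fun x => p' x * deriv (deriv ψ) (inner ℝ v x) :=
    integrable_mixtureDensity_mul hmax hmin hd hS' P'
      (Continuous.measurable (by fun_prop)) fun x => hM2' _
  have hA : ∫ x, p' x * H x = (∫ x, p' x * ψ (inner ℝ v x)) -
      1 / 2 * s * ∫ x, p' x * deriv (deriv ψ) (inner ℝ v x) := by
    rw [← integral_const_mul, ← integral_sub hiψ (hid.const_mul _)]
    exact integral_congr_ae (Filter.Eventually.of_forall fun x => by simp only [hH]; ring)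
  have hB : (∫ x, p' x * ψ (inner ℝ v x)) -
      1 / 2 * s' * ∫ x, p' x * deriv (deriv ψ) (inner ℝ v x) = 0 := by
    rw [← hinv', ← integral_const_mul, ← integral_sub hiψ (hid.const_mul _)]
    exact integral_congr_ae (Filter.Eventually.of_forall fun x => by ring)
  -- Here `∫ p H = 0`. The inversion for `p'` expresses `∫ p' ψ''` through `∫ p' ψ`, so only the
  -- discrepancy `s - s'` survives.
  have hC : ∫ x, (p x - p' x) * H x = (s - s') / s' * ∫ x, p' x * ψ (inner ℝ v x) := by
    simp_rw [sub_mul]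
    rw [integral_sub hi1 hi1', hinv, hA]
    set a := ∫ x, p' x * ψ (inner ℝ v x)
    set b := ∫ x, p' x * deriv (deriv ψ) (inner ℝ v x)
    have : a = 1 / 2 * s' * b := by linarith
    rw [this]; field_simp; ring
  have hlow : m ≤ ∫ x, p' x * ψ (inner ℝ v x) := by
    have hball : (volume : Measure (E d)).real (Metric.ball ((R + 2) • v) (1 / 2)) =
        (volume : Measure (E d)).real (Metric.ball (0 : E d) (1 / 2)) := by
      rw [measureReal_def, measureReal_def, Measure.addHaar_ball_center]
    rw [hm, ← hball, mul_comm, ← smul_eq_mul, ← integral_indicator_const _ measurableSet_ball]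
    refine integral_mono_ae ((integrable_indicator_iff measurableSet_ball).2
      (integrableOn_const measure_ball_lt_top.ne)) hiψ ?_
    -- Integrability of `θ ↦ f(x ∣ θ, S')` under `P'` comes from Fubini, hence only for almost every
    -- `x`.
    filter_upwards [(integrable_laplaceKernel_prod hmax hmin hd hS' P').prod_right_ae] with x hx
    by_cases hxb : x ∈ Metric.ball ((R + 2) • v) (1 / 2)
    · rw [indicator_of_mem hxb]
      rw [Metric.mem_ball, dist_eq_norm] at hxb
      have hin : inner ℝ v x = (R + 2) + inner ℝ v (x - (R + 2) • v) := by
        rw [inner_sub_right, inner_smul_right, real_inner_self_eq_norm_sq, hv]; ring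
      have habs : |inner ℝ v (x - (R + 2) • v)| ≤ 1 / 2 := by
        have := abs_real_inner_le_norm v (x - (R + 2) • v)
        rw [hv] at this
        linarith
      have hψ1 : ψ (inner ℝ v x) = 1 := by
        refine ψ.one_of_mem_closedBall ?_
        rw [Metric.mem_closedBall, Real.dist_eq, hin]
        change _ ≤ (1 / 2 : ℝ)
        simpa using habs
      have hxn : ‖x‖ ≤ R + 3 := by
        have h1 := norm_add_le (x - (R + 2) • v) ((R + 2) • v)
        rw [sub_add_cancel, norm_smul, hv, Real.norm_of_nonneg (by linarith)] at h1
        linarith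
      rw [hψ1, mul_one]
      calc densityBound d lmin lmax (2 * R + 3)
          = ∫ _θ, densityBound d lmin lmax (2 * R + 3) ∂P' := by simp
        _ ≤ ∫ θ, laplaceKernel d x θ S' ∂P' := by
            refine integral_mono_ae (integrable_const _) hx ?_
            filter_upwards [hsupp'] with θ hθ
            refine le_laplaceKernel hmax hmin hS' ?_ ?_
            · rintro rfl
              have := hle x
              rw [abs_le] at habs
              linarith
            · have := norm_sub_le x θ
              linarith
    · rw [indicator_of_notMem hxb]
      exact mul_nonneg (mixtureDensity_nonneg hmax hmin hS' P' x) ψ.nonneg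
  have hD := abs_integral_sub_mul_le hp hp' hHM
  rw [hC, abs_mul, abs_div, abs_of_pos hs0'] at hD
  have h1 : m ≤ |∫ x, p' x * ψ (inner ℝ v x)| := hlow.trans (le_abs_self _)
  have h2 : |s - s'| / lmax * m ≤ |s - s'| / s' * |∫ x, p' x * ψ (inner ℝ v x)| := by gcongr
  have h3 := h2.trans hD
  rw [div_mul_eq_mul_div, div_le_iff₀ hmax] at h3
  linarith

end ScaleBound

/-! ### Multi-index form of `T_S` and PDE inversion. -/

section MultiIndex

variable {d : ℕ}

theorem contDiff_infty_pderiv {φ : E d → ℝ} (hφ : ContDiff ℝ ∞ φ) (j : Fin d) :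
    ContDiff ℝ ∞ (pderiv j φ) :=
  contDiff_pderiv hφ (by simp) j

theorem contDiff_infty_iterate_pderiv {φ : E d → ℝ} (hφ : ContDiff ℝ ∞ φ) (j : Fin d) (n : ℕ) :
    ContDiff ℝ ∞ ((pderiv j)^[n] φ) := by
  induction n with
  | zero => exact hφ
  | succ n ih =>
    rw [Function.iterate_succ_apply']
    exact contDiff_infty_pderiv ih j

theorem pderiv_pderiv_eq {φ : E d → ℝ} (hφ : ContDiff ℝ 2 φ) (j k : Fin d) (x : E d) :
    pderiv j (pderiv k φ) x =
      fderiv ℝ (fderiv ℝ φ) x (EuclideanSpace.single j 1) (EuclideanSpace.single k 1) := by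
  have h1 : DifferentiableAt ℝ (fderiv ℝ φ) x :=
    ((hφ.fderiv_right (m := 1) (by norm_num)).differentiable one_ne_zero) x
  have h2 : HasFDerivAt (fun y => fderiv ℝ φ y (EuclideanSpace.single k (1 : ℝ))) _ x :=
    h1.hasFDerivAt.clm_apply (hasFDerivAt_const _ x)
  have h3 : fderiv ℝ (pderiv k φ) x = _ := h2.fderiv
  rw [pderiv, h3]
  simp

theorem pderiv_comm {φ : E d → ℝ} (hφ : ContDiff ℝ ∞ φ) (j k : Fin d) :
    pderiv j (pderiv k φ) = pderiv k (pderiv j φ) := by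
  have h2 : ContDiff ℝ 2 φ := mod_cast contDiff_infty.1 hφ 2
  ext x
  rw [pderiv_pderiv_eq h2, pderiv_pderiv_eq h2]
  exact (h2.contDiffAt.isSymmSndFDerivAt (by simp)) _ _

theorem iterate_pderiv_pderiv {φ : E d → ℝ} (hφ : ContDiff ℝ ∞ φ) (j k : Fin d) (n : ℕ) :
    (pderiv k)^[n] (pderiv j φ) = pderiv j ((pderiv k)^[n] φ) := by
  induction n with
  | zero => rfl
  | succ n ih =>
    rw [Function.iterate_succ_apply', ih, Function.iterate_succ_apply',
      pderiv_comm (contDiff_infty_iterate_pderiv hφ k n)]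

theorem contDiff_foldr_pderiv {φ : E d → ℝ} (hφ : ContDiff ℝ ∞ φ) (ν : Fin d → ℕ)
    (l : List (Fin d)) : ContDiff ℝ ∞ (l.foldr (fun j g => (pderiv j)^[ν j] g) φ) := by
  induction l with
  | nil => exact hφ
  | cons a t ih => exact contDiff_infty_iterate_pderiv ih a _

theorem foldr_pderiv_add_single_of_notMem (φ : E d → ℝ) (ν : Fin d → ℕ) (j : Fin d)
    (l : List (Fin d)) (hj : j ∉ l) :
    l.foldr (fun i g => (pderiv i)^[(ν + Pi.single j 1 : Fin d → ℕ) i] g) φ =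
      l.foldr (fun i g => (pderiv i)^[ν i] g) φ := by
  induction l with
  | nil => rfl
  | cons a t ih =>
    simp only [List.mem_cons, not_or] at hj
    rw [List.foldr_cons, List.foldr_cons, ih hj.2]
    simp [Ne.symm hj.1]

/-- The head of the list is the outermost derivative. The additional `∂_j` is created at the
position of `j` and commuted outwards past the others by symmetry of second derivatives. -/
theorem foldr_pderiv_add_single {φ : E d → ℝ} (hφ : ContDiff ℝ ∞ φ) (ν : Fin d → ℕ) (j : Fin d)
    (l : List (Fin d)) (hl : l.Nodup) (hj : j ∈ l) :
    l.foldr (fun i g => (pderiv i)^[(ν + Pi.single j 1 : Fin d → ℕ) i] g) φ =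
      pderiv j (l.foldr (fun i g => (pderiv i)^[ν i] g) φ) := by
  induction l with
  | nil => simp at hj
  | cons a t ih =>
    rw [List.nodup_cons] at hl
    rw [List.foldr_cons, List.foldr_cons]
    by_cases haj : a = j
    · subst haj
      rw [foldr_pderiv_add_single_of_notMem φ ν a t hl.1, Pi.add_apply, Pi.single_eq_same,
        Function.iterate_succ_apply']
    · have hjt : j ∈ t := (List.mem_cons.1 hj).resolve_left (Ne.symm haj)
      rw [ih hl.2 hjt, iterate_pderiv_pderiv (contDiff_foldr_pderiv hφ ν t)]
      simp [haj]

theorem multiDeriv_add_single {φ : E d → ℝ} (hφ : ContDiff ℝ ∞ φ) (ν : Fin d → ℕ) (j : Fin d) :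
    multiDeriv (ν + Pi.single j 1) φ = pderiv j (multiDeriv ν φ) :=
  foldr_pderiv_add_single hφ ν j _ (List.nodup_finRange d) (List.mem_finRange j)

theorem multiDeriv_zero (φ : E d → ℝ) : multiDeriv 0 φ = φ := by
  unfold multiDeriv
  induction List.finRange d with
  | nil => rfl
  | cons a t ih => rw [List.foldr_cons, ih]; rfl

theorem multiDeriv_single_add_single {φ : E d → ℝ} (hφ : ContDiff ℝ ∞ φ) (j k : Fin d) :
    multiDeriv (Pi.single j 1 + Pi.single k 1) φ = pderiv j (pderiv k φ) := by
  rw [add_comm, multiDeriv_add_single hφ, ← zero_add (Pi.single k 1), multiDeriv_add_single hφ,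
    multiDeriv_zero]

/-- The coefficients of `T_S` in multi-index notation. -/
def laplaceCoeff (ν : Fin d → ℕ) (S : Matrix (Fin d) (Fin d) ℝ) : ℝ :=
  (if ν = 0 then 1 else 0) -
    1 / 2 * ∑ j, ∑ k, if ν = Pi.single j 1 + Pi.single k 1 then S j k else 0

theorem sum_single_add_single (j k : Fin d) :
    ∑ i, ((Pi.single j 1 + Pi.single k 1 : Fin d → ℕ)) i = 2 := by
  simp [Finset.sum_add_distrib, Pi.single_apply]

/-- The arbitrary weight `F` lets one identity serve both `T_S` and its formal adjoint, where `F`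
carries the signs. The pairs `(j, k)` and `(k, j)` share a multi-index, so their entries add up in
one coefficient. -/
theorem sum_laplaceCoeff_mul (S : Matrix (Fin d) (Fin d) ℝ) (F : (Fin d → ℕ) → ℝ) :
    ∑ ν ∈ multiIndices d 2, laplaceCoeff ν S * F ν =
      F 0 - 1 / 2 * ∑ j, ∑ k, S j k * F (Pi.single j 1 + Pi.single k 1) := by
  have h0 : (0 : Fin d → ℕ) ∈ multiIndices d 2 := mem_multiIndices.2 (by simp)
  have h2 : ∀ j k : Fin d, (Pi.single j 1 + Pi.single k 1 : Fin d → ℕ) ∈ multiIndices d 2 :=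
    fun j k => mem_multiIndices.2 (sum_single_add_single j k).le
  simp only [laplaceCoeff, sub_mul, Finset.sum_sub_distrib, mul_assoc, ← Finset.mul_sum,
    Finset.sum_mul, ite_mul, one_mul, zero_mul]
  congr 1
  · simp [h0]
  · congr 1
    rw [Finset.sum_comm]
    refine Finset.sum_congr rfl fun j _ => ?_
    rw [Finset.sum_comm]
    refine Finset.sum_congr rfl fun k _ => ?_
    simp [h2 j k]

theorem boundedC2_of_hasCompactSupport {φ : E d → ℝ} (hφ : ContDiff ℝ 2 φ)
    (hc : HasCompactSupport φ) : BoundedC2 φ := by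
  have hp : ∀ (f : E d → ℝ), HasCompactSupport f → ∀ k, HasCompactSupport (pderiv k f) :=
    fun f hf k => hf.fderiv_apply ℝ _
  have h1 : ∀ k, ContDiff ℝ 1 (pderiv k φ) := fun k => contDiff_pderiv hφ (by norm_num) k
  have h2 : ∀ j k, ContDiff ℝ 0 (pderiv j (pderiv k φ)) := fun j k =>
    contDiff_pderiv (h1 k) (by norm_num) j
  obtain ⟨M0, hM0⟩ := hφ.continuous.bounded_above_of_compact_support hc
  choose M1 hM1 using fun k => (h1 k).continuous.bounded_above_of_compact_support (hp _ hc k)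
  choose M2 hM2 using fun j k =>
    (h2 j k).continuous.bounded_above_of_compact_support (hp _ (hp _ hc k) j)
  have hM0' : 0 ≤ M0 := (norm_nonneg _).trans (hM0 0)
  have hM1' : ∀ k, 0 ≤ M1 k := fun k => (norm_nonneg _).trans (hM1 k 0)
  have hM2' : ∀ j k, 0 ≤ M2 j k := fun j k => (norm_nonneg _).trans (hM2 j k 0)
  have hs1 : 0 ≤ ∑ k, M1 k := Finset.sum_nonneg fun k _ => hM1' k
  have hs2 : 0 ≤ ∑ j, ∑ k, M2 j k :=
    Finset.sum_nonneg fun j _ => Finset.sum_nonneg fun k _ => hM2' j k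
  refine ⟨hφ, M0 + ∑ k, M1 k + ∑ j, ∑ k, M2 j k, fun x => ⟨?_, fun k => ?_, fun j k => ?_⟩⟩
  · have := hM0 x
    rw [Real.norm_eq_abs] at this
    linarith
  · have h3 := hM1 k x
    rw [Real.norm_eq_abs] at h3
    have := Finset.single_le_sum (fun k _ => hM1' k) (Finset.mem_univ k)
    linarith
  · have h3 := hM2 j k x
    rw [Real.norm_eq_abs] at h3
    have h4 := Finset.single_le_sum (f := fun k => M2 j k) (fun k _ => hM2' j k) (Finset.mem_univ k)
    have h5 := Finset.single_le_sum (f := fun j => ∑ k, M2 j k)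
      (fun j _ => Finset.sum_nonneg fun k _ => hM2' j k) (Finset.mem_univ j)
    linarith

theorem pdeInversion_laplaceKernel {lmin lmax : ℝ} (hmin : 0 < lmin) (hmax : 0 < lmax)
    (hd : 1 ≤ d) (X : Set (E d)) :
    PDEInversion (laplaceKernel d) X lmin lmax 2 laplaceOp := by
  refine ⟨laplaceCoeff, fun S hS φ hφ x => ?_, ?_, ?_, fun G hG => ?_⟩
  · rw [sum_laplaceCoeff_mul S fun ν => multiDeriv ν φ x]
    simp_rw [multiDeriv_zero, multiDeriv_single_add_single hφ]
    rfl
  -- The multi-index `2 e_o` arises only from `j = k = o`; its coefficient `-S_{oo}/2` is nonzero by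
  -- positive definiteness.
  · set o : Fin d := ⟨0, hd⟩
    refine ⟨Pi.single o 1 + Pi.single o 1, sum_single_add_single o o, fun S hS => ?_⟩
    have hne : (Pi.single o 1 + Pi.single o 1 : Fin d → ℕ) ≠ 0 := fun h => by
      have := sum_single_add_single o o
      rw [h] at this
      simp at this
    have hiff : ∀ j k : Fin d, (Pi.single o 1 + Pi.single o 1 : Fin d → ℕ) =
        Pi.single j 1 + Pi.single k 1 ↔ j = o ∧ k = o := by
      refine fun j k => ⟨fun h => ?_, by rintro ⟨rfl, rfl⟩; rfl⟩
      have h1 := congrFun h o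
      simp only [Pi.add_apply, Pi.single_apply, if_true] at h1
      split_ifs at h1 with h2 h3 <;> simp_all
    have hpos : 0 < S o o := hS.1.diag_pos
    rw [laplaceCoeff, if_neg hne]
    simp_rw [hiff, ite_and]
    simp [hpos.ne']
  -- At most `d²` entries of `S - S'` contribute, each at most `3 opNorm (S - S')`, and the operator
  -- carries a factor `1/2`.
  · refine ⟨3 / 2 * (d : ℝ) ^ 2, by positivity, fun ν _ S hS S' hS' => ?_⟩
    have hsym : (S - S').IsSymm :=
      (isSymm_of_mem_scaleSet hS).sub (isSymm_of_mem_scaleSet hS')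
    have h1 : laplaceCoeff ν S - laplaceCoeff ν S' = -(1 / 2 * ∑ j, ∑ k,
        if ν = Pi.single j 1 + Pi.single k 1 then (S - S') j k else 0) := by
      have : ∀ j k, (if ν = Pi.single j 1 + Pi.single k 1 then (S - S') j k else 0) =
          (if ν = Pi.single j 1 + Pi.single k 1 then S j k else 0) -
            if ν = Pi.single j 1 + Pi.single k 1 then S' j k else 0 := fun j k => by
        split_ifs <;> simp
      simp_rw [this, Finset.sum_sub_distrib, laplaceCoeff]
      ring
    rw [h1, abs_neg, abs_mul, abs_of_pos (by norm_num : (0 : ℝ) < 1 / 2)]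
    have h2 : |∑ j, ∑ k, if ν = Pi.single j 1 + Pi.single k 1 then (S - S') j k else 0| ≤
        ∑ _j : Fin d, ∑ _k : Fin d, 3 * opNorm (S - S') := by
      refine (Finset.abs_sum_le_sum_abs _ _).trans (Finset.sum_le_sum fun j _ => ?_)
      refine (Finset.abs_sum_le_sum_abs _ _).trans (Finset.sum_le_sum fun k _ => ?_)
      split_ifs
      · exact abs_apply_le_opNorm hsym j k
      · simpa using opNorm_nonneg _
    simp only [Finset.sum_const, Finset.card_univ, Fintype.card_fin, nsmul_eq_mul] at h2
    linarith
  · obtain ⟨P, S⟩ := G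
    obtain ⟨hP, -, hS⟩ := hG
    simp only at hP hS ⊢
    refine ⟨(integrable_mixtureDensity hmax hmin hd hS P).locallyIntegrable, fun φ hφ hc => ?_⟩
    have h2 : ContDiff ℝ 2 φ := mod_cast contDiff_infty.1 hφ 2
    rw [← integral_mixtureDensity_mul_laplaceOp hmax hmin hd hS P
      (boundedC2_of_hasCompactSupport h2 hc)]
    refine integral_congr_ae (Filter.Eventually.of_forall fun x => ?_)
    simp only
    congr 1
    have h3 : ∀ ν : Fin d → ℕ, (-1 : ℝ) ^ (∑ j, ν j) * laplaceCoeff ν S * multiDeriv ν φ x =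
        laplaceCoeff ν S * ((-1 : ℝ) ^ (∑ j, ν j) * multiDeriv ν φ x) := fun ν => by ring
    simp_rw [h3]
    rw [sum_laplaceCoeff_mul S fun ν => (-1 : ℝ) ^ (∑ j, ν j) * multiDeriv ν φ x]
    -- Only the orders `0` and `2` occur, so all signs are `+1` and `T_S` is its own formal adjoint.
    simp_rw [sum_single_add_single, multiDeriv_zero, multiDeriv_single_add_single hφ]
    simp [laplaceOp]

end MultiIndex

/-! ### Kantorovich duality by Hahn–Banach and Riesz representation. -/

section Kantorovich

variable {X : Type*} [MetricSpace X] [CompactSpace X] [MeasurableSpace X] [BorelSpace X]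

theorem integrable_continuousMap {Y : Type*} [TopologicalSpace Y] [CompactSpace Y]
    [MeasurableSpace Y] [OpensMeasurableSpace Y] (P : Measure Y) [IsFiniteMeasure P]
    (f : C(Y, ℝ)) : Integrable f P :=
  (integrable_const ‖f‖).mono' f.continuous.measurable.aestronglyMeasurable
    (Filter.Eventually.of_forall fun x => f.norm_coe_le_norm x)

/-- The values of the dual bounds for a function `h` on the product, for the cost `c`. -/
def dualValues (P Q : Measure X) (c : C(X × X, ℝ)) (M : ℝ) (h : C(X × X, ℝ)) : Set ℝ :=
  {r | ∃ φ ψ : C(X, ℝ), ∃ t : ℝ, 0 ≤ t ∧ (∀ x y, h (x, y) ≤ φ x + ψ y + t * c (x, y)) ∧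
    r = ∫ x, φ x ∂P + ∫ y, ψ y ∂Q + t * M}

variable {P Q : Measure X} [IsProbabilityMeasure P] [IsProbabilityMeasure Q] {c : C(X × X, ℝ)}
  {M : ℝ}

/-- This keeps the infimum of the dual values finite, and it is where the dual bound `hM` enters. If
`t > 0`, the pair `-(φ + ‖h‖)/t`, `-ψ/t` is admissible for the cost `c`; if `t = 0`, integrate the
inequality in both variables. -/
theorem neg_norm_le_of_mem_dualValues
    (hM : ∀ φ ψ : C(X, ℝ), (∀ x y, φ x + ψ y ≤ c (x, y)) → ∫ x, φ x ∂P + ∫ y, ψ y ∂Q ≤ M)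
    {h : C(X × X, ℝ)} {r : ℝ} (hr : r ∈ dualValues P Q c M h) : -‖h‖ ≤ r := by
  obtain ⟨φ, ψ, t, ht, hle, rfl⟩ := hr
  have hh : ∀ x y, -‖h‖ ≤ φ x + ψ y + t * c (x, y) := fun x y =>
    (neg_le_of_abs_le (h.norm_coe_le_norm (x, y))).trans (hle x y)
  have hφ := integrable_continuousMap P φ
  have hψ := integrable_continuousMap Q ψ
  rcases ht.eq_or_lt with rfl | ht
  · have h1 : ∀ y, -‖h‖ - ψ y ≤ ∫ x, φ x ∂P := fun y => by
      have : ∫ _x, (-‖h‖ - ψ y) ∂P ≤ ∫ x, φ x ∂P :=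
        integral_mono (integrable_const _) hφ fun x => by
          have := hh x y
          simp only
          linarith
      simpa using this
    have h2 : ∫ y, (-‖h‖ - ∫ x, φ x ∂P) ∂Q ≤ ∫ y, ψ y ∂Q :=
      integral_mono (integrable_const _) hψ fun y => by
        have := h1 y
        simp only
        linarith
    simp only [integral_const, probReal_univ, one_smul] at h2
    linarith
  · have h1 := hM (-(t⁻¹ • (φ + ContinuousMap.const X ‖h‖))) (-(t⁻¹ • ψ)) fun x y => by
      have h2 := mul_le_mul_of_nonneg_left (hh x y) (inv_nonneg.2 ht.le)
      have h3 : t⁻¹ * (φ x + ψ y + t * c (x, y)) = t⁻¹ * φ x + t⁻¹ * ψ y + c (x, y) := by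
        field_simp
      simp only [ContinuousMap.neg_apply, ContinuousMap.smul_apply, ContinuousMap.add_apply,
        ContinuousMap.const_apply, smul_eq_mul]
      linarith
    simp only [ContinuousMap.neg_apply, ContinuousMap.smul_apply, ContinuousMap.add_apply,
      ContinuousMap.const_apply, smul_eq_mul, integral_neg, integral_const_mul] at h1
    rw [integral_add hφ (integrable_const _)] at h1
    simp only [integral_const, probReal_univ, one_smul] at h1
    have h2 := mul_le_mul_of_nonneg_left h1 ht.le
    have h3 : ∀ a b : ℝ, t * (-(t⁻¹ * a) + -(t⁻¹ * b)) = -a - b := fun a b => by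
      field_simp; ring
    rw [h3] at h2
    linarith

/-- **Kantorovich duality** on a compact metric space, in the form of a coupling whose cost is
bounded by any bound of the dual problem. -/
theorem exists_coupling_of_dual_le [SecondCountableTopology X]
    (hM : ∀ φ ψ : C(X, ℝ), (∀ x y, φ x + ψ y ≤ c (x, y)) → ∫ x, φ x ∂P + ∫ y, ψ y ∂Q ≤ M) :
    ∃ π : Measure (X × X), π.map Prod.fst = P ∧ π.map Prod.snd = Q ∧ IsFiniteMeasure π ∧
      ∫ z, c z ∂π ≤ M := by
  -- The sublinear `N` is built so that any linear functional below it is positive, has the right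
  -- marginals and costs at most `M`.
  set N : C(X × X, ℝ) → ℝ := fun h => sInf (dualValues P Q c M h) with hN
  have hbdd : ∀ h, BddBelow (dualValues P Q c M h) := fun h =>
    ⟨-‖h‖, fun r hr => neg_norm_le_of_mem_dualValues hM hr⟩
  have hne : ∀ h, (dualValues P Q c M h).Nonempty := fun h =>
    ⟨_, ContinuousMap.const X ‖h‖, 0, 0, le_rfl, fun x y => by
      simpa using (le_abs_self _).trans (h.norm_coe_le_norm (x, y)), rfl⟩
  have hNle : ∀ {h r}, r ∈ dualValues P Q c M h → N h ≤ r := fun hr => csInf_le (hbdd _) hr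
  have hhom_le : ∀ a : ℝ, 0 < a → ∀ h, N (a • h) ≤ a * N h := fun a ha h => by
    rw [mul_comm, ← div_le_iff₀ ha]
    refine le_csInf (hne h) ?_
    rintro r ⟨φ, ψ, t, ht, hle, rfl⟩
    rw [div_le_iff₀ ha]
    refine hNle ⟨a • φ, a • ψ, a * t, by positivity, fun x y => ?_, ?_⟩
    · have := mul_le_mul_of_nonneg_left (hle x y) ha.le
      simp only [ContinuousMap.smul_apply, smul_eq_mul]
      linarith
    · simp only [ContinuousMap.smul_apply, smul_eq_mul, integral_const_mul]
      ring
  have hhom : ∀ a : ℝ, 0 < a → ∀ h, N (a • h) = a * N h := fun a ha h => by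
    refine le_antisymm (hhom_le a ha h) ?_
    have h1 := hhom_le a⁻¹ (inv_pos.2 ha) (a • h)
    rw [inv_smul_smul₀ ha.ne', inv_mul_eq_div, le_div_iff₀ ha] at h1
    linarith
  have hadd : ∀ h k, N (h + k) ≤ N h + N k := fun h k => by
    rw [← sub_le_iff_le_add]
    refine le_csInf (hne h) fun r hr => ?_
    rw [sub_le_comm]
    refine le_csInf (hne k) fun r' hr' => ?_
    rw [sub_le_iff_le_add']
    obtain ⟨φ, ψ, t, ht, hle, rfl⟩ := hr
    obtain ⟨φ', ψ', t', ht', hle', rfl⟩ := hr'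
    refine hNle ⟨φ + φ', ψ + ψ', t + t', by positivity, fun x y => ?_, ?_⟩
    · have h1 := hle x y
      have h2 := hle' x y
      simp only [ContinuousMap.add_apply]
      linarith
    · simp only [ContinuousMap.add_apply]
      rw [integral_add (integrable_continuousMap P φ) (integrable_continuousMap P φ'),
        integral_add (integrable_continuousMap Q ψ) (integrable_continuousMap Q ψ')]
      ring
  -- Hahn–Banach starts from the zero subspace: all constraints are already encoded in `N`, so any
  -- linear `g ≤ N` will do.
  obtain ⟨g, -, hg⟩ := exists_extension_of_le_sublinear (⊥ : C(X × X, ℝ) →ₗ.[ℝ] ℝ) N hhom hadd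
    (fun x => by
      have hx : (x : C(X × X, ℝ)) = 0 := (Submodule.mem_bot ℝ).1 x.2
      have hx0 : x = 0 := Subtype.ext hx
      rw [hx0, LinearPMap.map_zero]
      refine le_csInf (hne _) fun r hr => ?_
      simpa using neg_norm_le_of_mem_dualValues hM hr)
  have hgneg : ∀ h : C(X × X, ℝ), (∀ z, h z ≤ 0) → g h ≤ 0 := fun h hh =>
    (hg h).trans (hNle ⟨0, 0, 0, le_rfl, fun x y => by simpa using hh (x, y), by simp⟩)
  let L : CompactlySupportedContinuousMap (X × X) ℝ →ₗ[ℝ] ℝ :=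
    { toFun := fun f => g f.toContinuousMap
      map_add' := fun f f' => g.map_add f.toContinuousMap f'.toContinuousMap
      map_smul' := fun a f => g.map_smul a f.toContinuousMap }
  let Λ : CompactlySupportedContinuousMap (X × X) ℝ →ₚ[ℝ] ℝ := PositiveLinearMap.mk₀ L
    fun f hf => by
      have h1 := hgneg (-f.toContinuousMap) fun z => neg_nonpos.2 (hf z)
      rw [map_neg] at h1
      exact neg_nonpos.1 h1
  set π := RealRMK.rieszMeasure Λ with hπ
  have hint : ∀ h : C(X × X, ℝ), ∫ z, h z ∂π = g h := fun h =>
    RealRMK.integral_rieszMeasure Λ (CompactlySupportedContinuousMap.continuousMapEquiv h)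
  have hreg : π.Regular := by rw [hπ]; infer_instance
  have hfin : IsFiniteMeasure π := inferInstance
  have hfst : ∀ φ : C(X, ℝ), g (φ.comp ContinuousMap.fst) ≤ ∫ x, φ x ∂P := fun φ =>
    (hg _).trans (hNle ⟨φ, 0, 0, le_rfl, fun x y => by simp, by simp⟩)
  have hsnd : ∀ φ : C(X, ℝ), g (φ.comp ContinuousMap.snd) ≤ ∫ x, φ x ∂Q := fun φ =>
    (hg _).trans (hNle ⟨0, φ, 0, le_rfl, fun x y => by simp, by simp⟩)
  -- A linear functional dominated by an integral equals it: apply the inequality to both `φ` and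
  -- `-φ`.
  have hmarg : ∀ (T : C(X × X, X)) (P' : Measure X) [IsFiniteMeasure P'],
      (∀ φ : C(X, ℝ), g (φ.comp T) ≤ ∫ x, φ x ∂P') → π.map T = P' := by
    intro T P' _ hT
    refine ext_of_forall_integral_eq_of_IsFiniteMeasure fun f => ?_
    rw [integral_map T.continuous.aemeasurable f.continuous.aestronglyMeasurable]
    have h1 := hT f.toContinuousMap
    have h2 := hT (-f.toContinuousMap)
    rw [← hint] at h1 h2
    simp only [ContinuousMap.comp_apply, ContinuousMap.neg_apply, integral_neg] at h1 h2
    exact le_antisymm h1 (neg_le_neg_iff.1 h2)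
  refine ⟨π, hmarg ContinuousMap.fst P hfst, hmarg ContinuousMap.snd Q hsnd, hfin, ?_⟩
  rw [hint]
  -- The choice `φ = ψ = 0`, `t = 1` is admissible for `h = c` and has dual value `M`.
  exact (hg c).trans (hNle ⟨0, 0, 1, zero_le_one, fun x y => by simp, by simp⟩)

end Kantorovich

/-! ### From couplings to bounded Lipschitz test functions. -/

section Wasserstein

variable {d : ℕ} {R : ℝ}

/-- The Kantorovich–Rubinstein bound for the Wasserstein distance of measures on a ball. -/
theorem wasserstein1_le_of_lipschitz (hR : 0 ≤ R) {P P' : Measure (E d)} [IsProbabilityMeasure P]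
    [IsProbabilityMeasure P'] (hP : ∀ᵐ θ ∂P, ‖θ‖ ≤ R) (hP' : ∀ᵐ θ ∂P', ‖θ‖ ≤ R) {M : ℝ}
    (hM : ∀ φ : E d → ℝ, LipschitzWith 1 φ → (∀ x, |φ x| ≤ R) →
      ∫ θ, φ θ ∂P - ∫ θ, φ θ ∂P' ≤ M) : wasserstein1 P P' ≤ M := by
  set K := Metric.closedBall (0 : E d) R with hK
  have hM0 : 0 ≤ M := by
    simpa using hM (fun _ => 0) (LipschitzWith.const' 0) (by simpa using hR)
  have hKm : MeasurableSet K := measurableSet_closedBall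
  have hKc : CompactSpace K := isCompact_iff_compactSpace.1 (isCompact_closedBall _ _)
  have hval : MeasurableEmbedding (Subtype.val : K → E d) := MeasurableEmbedding.subtype_coe hKm
  have hmap : ∀ (μ : Measure (E d)), (∀ᵐ θ ∂μ, ‖θ‖ ≤ R) →
      (μ.comap (Subtype.val : K → E d)).map Subtype.val = μ := fun μ hμ => by
    rw [hval.map_comap, Subtype.range_coe]
    refine Measure.restrict_eq_self_of_ae_mem (hμ.mono fun θ hθ => ?_)
    simpa [hK] using hθ
  have hprob : ∀ (μ : Measure (E d)) [IsProbabilityMeasure μ], (∀ᵐ θ ∂μ, ‖θ‖ ≤ R) →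
      IsProbabilityMeasure (μ.comap (Subtype.val : K → E d)) := fun μ _ hμ => by
    refine ⟨?_⟩
    rw [← measure_univ (μ := μ), ← hmap μ hμ, hval.map_apply, preimage_univ, hmap μ hμ]
  have hintv : ∀ (μ : Measure (E d)) (hμ : ∀ᵐ θ ∂μ, ‖θ‖ ≤ R) (F : E d → ℝ),
      ∫ x : K, F x ∂(μ.comap (Subtype.val : K → E d)) = ∫ θ, F θ ∂μ := fun μ hμ F => by
    conv_rhs => rw [← hmap μ hμ]
    rw [hval.integral_map]
  have hp := hprob P hP
  have hp' := hprob P' hP'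
  set p := P.comap (Subtype.val : K → E d)
  set p' := P'.comap (Subtype.val : K → E d)
  have h0K : (0 : E d) ∈ K := by simpa [hK] using hR
  have hneK : Nonempty K := ⟨⟨0, h0K⟩⟩
  let c : C(K × K, ℝ) := ⟨fun z => dist z.1 z.2, by fun_prop⟩
  obtain ⟨π, h1, h2, hfin, h3⟩ := exists_coupling_of_dual_le (P := p) (Q := p') (c := c) (M := M)
    fun φ ψ hle => by
      -- The `c`-transform of `ψ`: as an infimum of distances it is 1-Lipschitz on the whole space,
      -- and `φ ≤ F`, `ψ ≤ -F` on the ball. One Lipschitz function thus replaces the pair.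
      set F : E d → ℝ := fun z => ⨅ y : K, (dist z (y : E d) - ψ y) with hF
      have hb : ∀ z : E d, BddBelow (range fun y : K => dist z (y : E d) - ψ y) := fun z =>
        ⟨-‖ψ‖, by
          rintro _ ⟨y, rfl⟩
          have h1 := (le_abs_self _).trans (ψ.norm_coe_le_norm y)
          have h2 := dist_nonneg (x := z) (y := (y : E d))
          simp only
          linarith⟩
      have hFlip : LipschitzWith 1 F := LipschitzWith.of_le_add fun z z' => by
        rw [← sub_le_iff_le_add]
        refine le_ciInf fun y => ?_
        have h1 := ciInf_le (hb z) y
        have h2 := dist_triangle z z' y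
        change F z ≤ _ at h1
        linarith
      have hφF : ∀ x : K, φ x ≤ F x := fun x => le_ciInf fun y => by
        have h1 : φ x + ψ y ≤ dist (x : E d) y := hle x y
        linarith
      have hψF : ∀ y : K, ψ y ≤ -F y := fun y => by
        have h1 := ciInf_le (hb y) y
        rw [dist_self] at h1
        change F y ≤ _ at h1
        linarith
      -- On the ball `|F - F 0| ≤ R`, so truncation changes nothing there while making the function
      -- globally bounded. The constant `F 0` cancels between the two probability measures.
      set G : E d → ℝ := fun z => max (-R) (min R (F z - F 0)) with hG
      have hGlip : LipschitzWith 1 G := by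
        have h1 : LipschitzWith 1 fun z => F z - F 0 := LipschitzWith.of_le_add fun z z' => by
          have h2 := (le_abs_self _).trans (hFlip.dist_le_mul z z')
          simp only [NNReal.coe_one, one_mul] at h2
          linarith
        exact (h1.const_min R).const_max (-R)
      have hGb : ∀ x, |G x| ≤ R := fun x =>
        abs_le.2 ⟨le_max_left _ _, max_le (by linarith) (min_le_left _ _)⟩
      have hGF : ∀ x : K, F x = G x + F 0 := fun x => by
        have h1 := hFlip.dist_le_mul x 0
        have h2 : dist (x : E d) 0 ≤ R := x.2
        simp only [NNReal.coe_one, one_mul, Real.dist_eq] at h1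
        have h3 := abs_le.1 (h1.trans h2)
        simp only [hG]
        rw [min_eq_right h3.2, max_eq_right h3.1]
        ring
      have hFc : Continuous F := hFlip.continuous
      have hGc : Continuous G := hGlip.continuous
      have hFint : ∀ (μ : Measure K) [IsFiniteMeasure μ], Integrable (fun x : K => F x) μ :=
        fun μ _ => integrable_continuousMap μ ⟨fun x : K => F x, by fun_prop⟩
      have hGint : ∀ (μ : Measure K) [IsFiniteMeasure μ], Integrable (fun x : K => G x) μ :=
        fun μ _ => integrable_continuousMap μ ⟨fun x : K => G x, by fun_prop⟩
      have h4 : ∫ x, φ x ∂p ≤ ∫ x : K, G x ∂p + F 0 := by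
        have h5 : ∫ x, φ x ∂p ≤ ∫ x : K, (G x + F 0) ∂p :=
          integral_mono (integrable_continuousMap p φ) ((hGint p).add (integrable_const _))
            fun x => (hφF x).trans (hGF x).le
        rw [integral_add (hGint p) (integrable_const _)] at h5
        simpa using h5
      have h5 : ∫ x, ψ x ∂p' ≤ -(∫ x : K, G x ∂p' + F 0) := by
        have h6 : ∫ x, ψ x ∂p' ≤ ∫ x : K, -(G x + F 0) ∂p' :=
          integral_mono (integrable_continuousMap p' ψ)
            (((hGint p').add (integrable_const _)).neg)
            fun x => (hψF x).trans (neg_le_neg (hGF x).ge)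
        rw [integral_neg, integral_add (hGint p') (integrable_const _)] at h6
        simpa using h6
      have h6 := hM G hGlip hGb
      rw [hintv P hP] at h4
      rw [hintv P' hP'] at h5
      linarith
  have hvv : Measurable (Prod.map Subtype.val Subtype.val : K × K → E d × E d) :=
    hval.measurable.prodMap hval.measurable
  refine ENNReal.toReal_le_of_le_ofReal hM0 ?_
  refine (iInf₂_le (π.map (Prod.map Subtype.val Subtype.val)) ⟨?_, ?_⟩).trans ?_
  · rw [lintegral_map (by fun_prop) hvv]
    refine le_trans (le_of_eq ?_) (ENNReal.ofReal_le_ofReal h3)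
    rw [ofReal_integral_eq_lintegral_ofReal (integrable_continuousMap π c)
      (Filter.Eventually.of_forall fun z => (dist_nonneg : 0 ≤ dist z.1 z.2))]
    exact lintegral_congr fun z => edist_dist _ _
  · rw [Measure.map_map measurable_fst hvv]
    have : (Prod.fst ∘ Prod.map Subtype.val Subtype.val : K × K → E d) =
        Subtype.val ∘ Prod.fst := rfl
    rw [this, ← Measure.map_map hval.measurable measurable_fst, h1, hmap P hP]
  · rw [Measure.map_map measurable_snd hvv]
    have : (Prod.snd ∘ Prod.map Subtype.val Subtype.val : K × K → E d) =
        Subtype.val ∘ Prod.snd := rfl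
    rw [this, ← Measure.map_map hval.measurable measurable_snd, h2, hmap P' hP']

end Wasserstein

/-! ### Mollification of Lipschitz functions. -/

section Smoothing

variable {d : ℕ} {g : E d → ℝ}

theorem integrable_comp_sub_mul (hg : Continuous g) {f : E d → ℝ} (hf : Continuous f)
    (hfc : HasCompactSupport f) (x : E d) : Integrable fun t => g (x - t) * f t :=
  Continuous.integrable_of_hasCompactSupport (by fun_prop) hfc.mul_left

theorem abs_integral_comp_sub_mul_sub_le (hg : LipschitzWith 1 g) {f : E d → ℝ}
    (hf : Continuous f) (hfc : HasCompactSupport f) (x x' : E d) :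
    |(∫ t, g (x - t) * f t) - ∫ t, g (x' - t) * f t| ≤ (∫ t, |f t|) * ‖x - x'‖ := by
  rw [← integral_sub (integrable_comp_sub_mul hg.continuous hf hfc x)
    (integrable_comp_sub_mul hg.continuous hf hfc x'), ← integral_mul_const, ← Real.norm_eq_abs]
  refine norm_integral_le_of_norm_le
    ((hf.integrable_of_hasCompactSupport hfc).abs.mul_const _)
    (Filter.Eventually.of_forall fun t => ?_)
  have h := hg.dist_le_mul (x - t) (x' - t)
  rw [dist_sub_right, NNReal.coe_one, one_mul, Real.dist_eq, dist_eq_norm] at h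
  rw [← sub_mul, norm_mul, mul_comm]
  exact mul_le_mul_of_nonneg_left h (abs_nonneg _)

/-- One derivative is paid for by the Lipschitz bound on `g`, so `f` only needs to be continuous.
Taking for `f` the mollifier and then its partial derivatives bounds the first and second
derivatives of the smoothing. -/
theorem abs_pderiv_integral_comp_sub_mul_le (hg : LipschitzWith 1 g) {f : E d → ℝ}
    (hf : Continuous f) (hfc : HasCompactSupport f) (j : Fin d) (x : E d) :
    |pderiv j (fun x => ∫ t, g (x - t) * f t) x| ≤ ∫ t, |f t| := by
  have h0 : 0 ≤ ∫ t, |f t| := integral_nonneg fun t => abs_nonneg _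
  have h1 : LipschitzWith (∫ t, |f t|).toNNReal fun x => ∫ t, g (x - t) * f t :=
    LipschitzWith.of_dist_le_mul fun x x' => by
      rw [Real.dist_eq, dist_eq_norm, Real.coe_toNNReal _ h0]
      exact abs_integral_comp_sub_mul_sub_le hg hf hfc x x'
  have h2 := norm_fderiv_le_of_lipschitz ℝ h1 (x₀ := x)
  rw [Real.coe_toNNReal _ h0] at h2
  have h3 := (fderiv ℝ (fun x => ∫ t, g (x - t) * f t) x).le_opNorm
    (EuclideanSpace.single j (1 : ℝ))
  rw [PiLp.norm_single, norm_one, mul_one] at h3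
  exact h3.trans h2

theorem integral_comp_sub_mul_eq_convolution (g f : E d → ℝ) :
    (fun x => ∫ t, g (x - t) * f t) =
      convolution g f (ContinuousLinearMap.lsmul ℝ ℝ) volume := by
  ext x
  rw [convolution_lsmul_swap]
  rfl

theorem pderiv_integral_comp_sub_mul (hg : Continuous g) {f : E d → ℝ} (hf : ContDiff ℝ 1 f)
    (hfc : HasCompactSupport f) (j : Fin d) :
    pderiv j (fun x => ∫ t, g (x - t) * f t) = fun x => ∫ t, g (x - t) * pderiv j f t := by
  rw [integral_comp_sub_mul_eq_convolution, integral_comp_sub_mul_eq_convolution]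
  ext x
  rw [pderiv, (hfc.hasFDerivAt_convolution_right _ hg.locallyIntegrable hf x).fderiv,
    convolution_precompR_apply _ hg.locallyIntegrable (hfc.fderiv ℝ)
      (hf.continuous_fderiv one_ne_zero)]
  rfl

/-- Regularization of Lipschitz functions at unit scale. -/
theorem exists_smoothing (d : ℕ) : ∃ C : ℝ, 0 ≤ C ∧ ∀ g : E d → ℝ, LipschitzWith 1 g →
    ∃ G : E d → ℝ, ContDiff ℝ 2 G ∧ (∀ x, |G x - g x| ≤ 1) ∧ (∀ k x, |pderiv k G x| ≤ C) ∧
      ∀ j k x, |pderiv j (pderiv k G) x| ≤ C := by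
  let b : ContDiffBump (0 : E d) := ⟨1 / 2, 1, by norm_num, by norm_num⟩
  set κ : E d → ℝ := b.normed volume with hκ
  have hκ2 : ContDiff ℝ 2 κ := b.contDiff_normed
  have hκ1 : ContDiff ℝ 1 κ := b.contDiff_normed
  have hκc : HasCompactSupport κ := b.hasCompactSupport_normed
  have hκ0 : ∀ t, 0 ≤ κ t := b.nonneg_normed
  have hκi : Integrable κ := b.integrable_normed
  have hκint : ∫ t, κ t = 1 := b.integral_normed
  have hp : ∀ k, Continuous (pderiv k κ) := fun k =>
    (contDiff_pderiv (m := 1) hκ2 (by norm_num) k).continuous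
  have hpc : ∀ k, HasCompactSupport (pderiv k κ) := fun k => hκc.fderiv_apply ℝ _
  have hI : ∀ k, 0 ≤ ∫ t, |pderiv k κ t| := fun k => integral_nonneg fun t => abs_nonneg _
  have hI' : 0 ≤ ∑ k, ∫ t, |pderiv k κ t| := Finset.sum_nonneg fun k _ => hI k
  -- The `1` is the mass of the mollifier and bounds the first derivatives; the sum bounds the
  -- second ones.
  refine ⟨1 + ∑ k, ∫ t, |pderiv k κ t|, by positivity, fun g hg => ?_⟩
  refine ⟨fun x => ∫ t, g (x - t) * κ t, ?_, fun x => ?_, fun k x => ?_, fun j k x => ?_⟩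
  · rw [integral_comp_sub_mul_eq_convolution]
    exact hκc.contDiff_convolution_right (n := 2) _ hg.continuous.locallyIntegrable hκ2
  · have h1 : (∫ t, g (x - t) * κ t) - g x = ∫ t, (g (x - t) * κ t - g x * κ t) := by
      rw [integral_sub (integrable_comp_sub_mul hg.continuous hκ2.continuous hκc x)
        (hκi.const_mul _), integral_const_mul, hκint, mul_one]
    rw [h1, ← hκint, ← Real.norm_eq_abs]
    refine norm_integral_le_of_norm_le hκi (Filter.Eventually.of_forall fun t => ?_)
    rw [← sub_mul, norm_mul, Real.norm_of_nonneg (hκ0 t)]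
    by_cases ht : t ∈ Metric.ball (0 : E d) 1
    · refine mul_le_of_le_one_left (hκ0 t) ?_
      have h := hg.dist_le_mul (x - t) x
      rw [NNReal.coe_one, one_mul, Real.dist_eq, dist_eq_norm] at h
      refine h.trans ?_
      rw [sub_sub_cancel_left, norm_neg]
      exact (mem_ball_zero_iff.1 ht).le
    · have : κ t = 0 := by
        by_contra h
        exact ht (b.support_normed_eq (μ := volume) ▸ h : t ∈ Metric.ball 0 b.rOut)
      simp [this]
  · have h := abs_pderiv_integral_comp_sub_mul_le hg hκ2.continuous hκc k x
    simp_rw [abs_of_nonneg (hκ0 _), hκint] at h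
    linarith
  · rw [pderiv_integral_comp_sub_mul hg.continuous hκ1 hκc]
    have h := abs_pderiv_integral_comp_sub_mul_le hg (hp k) (hpc k) j x
    have h2 := Finset.single_le_sum (fun k _ => hI k) (Finset.mem_univ k)
    linarith

/-- Regularization of bounded Lipschitz functions at scale `δ`. -/
theorem exists_smoothing_scale (d : ℕ) : ∃ C : ℝ, 0 ≤ C ∧ ∀ (φ : E d → ℝ) (R : ℝ),
    LipschitzWith 1 φ → (∀ x, |φ x| ≤ R) → ∀ δ : ℝ, 0 < δ →
    ∃ G : E d → ℝ, BoundedC2 G ∧ (∀ x, |G x - φ x| ≤ δ) ∧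
      ∀ j k x, |pderiv j (pderiv k G) x| ≤ C / δ := by
  obtain ⟨C, hC0, hC⟩ := exists_smoothing d
  refine ⟨C, hC0, fun φ R hφ hR δ hδ => ?_⟩
  -- The rescaling `δ⁻¹ φ(δ z)` preserves the Lipschitz constant. Undoing it multiplies the error by
  -- `δ` and the second derivatives by `δ⁻¹`.
  have hg : LipschitzWith 1 fun z : E d => δ⁻¹ * φ (δ • z) :=
    LipschitzWith.of_dist_le_mul fun z z' => by
      have h := hφ.dist_le_mul (δ • z) (δ • z')
      rw [NNReal.coe_one, one_mul, dist_smul₀, Real.norm_of_nonneg hδ.le] at h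
      rw [NNReal.coe_one, one_mul, Real.dist_eq, ← mul_sub, abs_mul, abs_of_pos (inv_pos.2 hδ),
        inv_mul_le_iff₀ hδ]
      exact h
  obtain ⟨G, hG2, hGg, hG1, hGd⟩ := hC _ hg
  have hR0 : 0 ≤ R := (abs_nonneg _).trans (hR 0)
  set F : E d → ℝ := fun x => δ * G (0 + δ⁻¹ • x) with hF
  have hGdiff : Differentiable ℝ G := hG2.differentiable (by norm_num)
  have hG1d : ∀ k, Differentiable ℝ (pderiv k G) := fun k =>
    (contDiff_pderiv (m := 1) hG2 (by norm_num) k).differentiable one_ne_zero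
  have hF1 : ∀ k, pderiv k F = fun x => pderiv k G (0 + δ⁻¹ • x) := fun k => by
    rw [hF, pderiv_const_mul (f := fun x => G (0 + δ⁻¹ • x)) (by fun_prop)]
    ext x
    rw [pderiv_comp_add_smul hGdiff, mul_inv_cancel_left₀ hδ.ne']
  have hF2 : ∀ j k x, pderiv j (pderiv k F) x = δ⁻¹ * pderiv j (pderiv k G) (0 + δ⁻¹ • x) :=
    fun j k x => by rw [hF1, pderiv_comp_add_smul (hG1d k)]
  have hF2b : ∀ j k x, |pderiv j (pderiv k F) x| ≤ C / δ := fun j k x => by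
    rw [hF2, abs_mul, abs_of_pos (inv_pos.2 hδ), div_eq_inv_mul]
    exact mul_le_mul_of_nonneg_left (hGd j k _) (inv_pos.2 hδ).le
  have hF0 : ∀ x, |F x - φ x| ≤ δ := fun x => by
    have h := mul_le_mul_of_nonneg_left (hGg (0 + δ⁻¹ • x)) hδ.le
    rw [zero_add, smul_inv_smul₀ hδ.ne', mul_one, ← abs_of_pos hδ, ← abs_mul, abs_of_pos hδ,
      mul_sub, mul_inv_cancel_left₀ hδ.ne'] at h
    simpa [hF] using h
  have hCδ : 0 ≤ C / δ := by positivity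
  refine ⟨F, ⟨?_, R + δ + C + C / δ, fun x => ⟨?_, fun k => ?_, fun j k => ?_⟩⟩, hF0, hF2b⟩
  · exact contDiff_const.mul (hG2.comp (contDiff_const.add (contDiff_id.const_smul δ⁻¹)))
  · have h1 := abs_le.1 (hF0 x)
    have h2 := abs_le.1 (hR x)
    rw [abs_le]
    constructor <;> linarith
  · rw [hF1]
    have := hG1 k (0 + δ⁻¹ • x)
    linarith
  · have := hF2b j k x
    linarith

end Smoothing

/-! ### The inverse bound. -/

section InverseBound

variable {d : ℕ} {lmin lmax R : ℝ} {S S' : Matrix (Fin d) (Fin d) ℝ}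

theorem integral_mixtureDensity (hmax : 0 < lmax) (hmin : 0 < lmin) (hd : 1 ≤ d)
    (hS : S ∈ scaleSet d lmin lmax) (P : Measure (E d)) [IsProbabilityMeasure P] :
    ∫ x, mixtureDensity (laplaceKernel d) ⟨P, S⟩ x = 1 := by
  have h := integral_mixtureDensity_mul hmax hmin hd hS P (H := fun _ => 1) (M := 1)
    measurable_const (by simp)
  simpa [integral_laplaceKernel hmax hmin hd hS] using h

theorem abs_sum_mul_le {A D : Fin d → Fin d → ℝ} {a b : ℝ} (hA : ∀ j k, |A j k| ≤ a)
    (hD : ∀ j k, |D j k| ≤ b) : |∑ j, ∑ k, A j k * D j k| ≤ (d : ℝ) ^ 2 * (a * b) := by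
  have h : |∑ j, ∑ k, A j k * D j k| ≤ ∑ _j : Fin d, ∑ _k : Fin d, a * b := by
    refine (Finset.abs_sum_le_sum_abs _ _).trans (Finset.sum_le_sum fun j _ => ?_)
    refine (Finset.abs_sum_le_sum_abs _ _).trans (Finset.sum_le_sum fun k _ => ?_)
    rw [abs_mul]
    exact mul_le_mul (hA j k) (hD j k) (abs_nonneg _) ((abs_nonneg _).trans (hA j k))
  refine h.trans (le_of_eq ?_)
  simp
  ring

/-- The Wasserstein distance is controlled by the `L¹` distance and the regularization scale. -/
theorem exists_wasserstein1_le (hmin : 0 < lmin) (hmax : 0 < lmax) (hd : 1 ≤ d) (hR : 0 < R) :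
    ∃ A : ℝ, 0 ≤ A ∧ ∀ X : Set (E d), MeasurableSet X → X ⊆ Metric.closedBall 0 R →
      ∀ G ∈ mixingClass X lmin lmax, ∀ G' ∈ mixingClass X lmin lmax, ∀ δ : ℝ, 0 < δ →
        wasserstein1 G.P G'.P ≤ 2 * δ +
          l1Dist (mixtureDensity (laplaceKernel d) G) (mixtureDensity (laplaceKernel d) G') *
            (R + δ + A / δ) := by
  obtain ⟨C, hC0, hC⟩ := exists_smoothing_scale d
  obtain ⟨-, c, hc0, hc⟩ := scaleLowerBound_laplaceKernel hmin hmax hd hR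
  -- The term in `lmax` bounds the second-order part of `T_S F`. The term in `1/c` comes from `T_S -
  -- T_{S'}`, whose coefficients the scale bound controls by `l/c`.
  refine ⟨3 / 2 * (d : ℝ) ^ 2 * C * (lmax + 1 / c), by positivity,
    fun X hXm hX G hG G' hG' δ hδ => ?_⟩
  have hop := hc X hXm hX G hG G' hG'
  have hsupp := ae_norm_le_of_mem_mixingClass hX hG
  have hsupp' := ae_norm_le_of_mem_mixingClass hX hG'
  obtain ⟨hP, -, hS⟩ := hG
  obtain ⟨hP', -, hS'⟩ := hG'
  obtain ⟨P, S⟩ := G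
  obtain ⟨P', S'⟩ := G'
  simp only at hsupp hsupp' hP hP' hS hS' hop ⊢
  set p := mixtureDensity (laplaceKernel d) ⟨P, S⟩
  set p' := mixtureDensity (laplaceKernel d) ⟨P', S'⟩
  have hp : Integrable p := integrable_mixtureDensity hmax hmin hd hS P
  have hp' : Integrable p' := integrable_mixtureDensity hmax hmin hd hS' P'
  set l := l1Dist p p'
  have hop' : opNorm (S - S') ≤ l / c := by rwa [le_div_iff₀' hc0]
  refine wasserstein1_le_of_lipschitz hR.le hsupp hsupp' fun φ hφ hφR => ?_
  obtain ⟨F, hF, hFφ, hF2⟩ := hC φ R hφ hφR δ hδ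
  have hT : ∀ x, |laplaceOp S F x| ≤ R + δ + 3 / 2 * (d : ℝ) ^ 2 * lmax * (C / δ) := fun x => by
    have h1 := abs_sum_mul_le (fun j k => abs_apply_le_of_mem_scaleSet hmin hmax hS j k)
      (fun j k => hF2 j k x)
    have h2 := abs_le.1 (hFφ x)
    have h3 := abs_le.1 (hφR x)
    have h4 : |F x| ≤ R + δ := abs_le.2 (by constructor <;> linarith)
    refine (abs_sub _ _).trans ?_
    rw [abs_mul, abs_of_pos (by norm_num : (0 : ℝ) < 1 / 2)]
    linarith
  have hT' : ∀ x, |laplaceOp S F x - laplaceOp S' F x| ≤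
      3 / 2 * (d : ℝ) ^ 2 * (l / c) * (C / δ) := fun x => by
    have hsym : (S - S').IsSymm := (isSymm_of_mem_scaleSet hS).sub (isSymm_of_mem_scaleSet hS')
    have h1 := abs_sum_mul_le (A := fun j k => (S - S') j k)
      (fun j k => (abs_apply_le_opNorm hsym j k).trans
        (mul_le_mul_of_nonneg_left hop' (by norm_num)))
      (fun j k => hF2 j k x)
    have h2 : laplaceOp S F x - laplaceOp S' F x =
        -(1 / 2 * ∑ j, ∑ k, (S - S') j k * pderiv j (pderiv k F) x) := by
      simp only [laplaceOp, Matrix.sub_apply, sub_mul, Finset.sum_sub_distrib]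
      ring
    rw [h2, abs_neg, abs_mul, abs_of_pos (by norm_num : (0 : ℝ) < 1 / 2)]
    linarith
  have hinv := integral_mixtureDensity_mul_laplaceOp hmax hmin hd hS P hF
  have hinv' := integral_mixtureDensity_mul_laplaceOp hmax hmin hd hS' P' hF
  obtain ⟨M', hM'⟩ := hF.exists_abs_laplaceOp_le S'
  have hcT := (continuous_laplaceOp hF.1 S).measurable
  have hcT' := (continuous_laplaceOp hF.1 S').measurable
  have hi1 := integrable_mixtureDensity_mul hmax hmin hd hS P hcT hT
  have hi2 := integrable_mixtureDensity_mul hmax hmin hd hS' P' hcT hT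
  have hi3 := integrable_mixtureDensity_mul hmax hmin hd hS' P' hcT' hM'
  -- Both inversions are applied to the same `F`; `∫ p' T_S F` is added and subtracted.
  have hsplit : ∫ θ, F θ ∂P - ∫ θ, F θ ∂P' = (∫ x, (p x - p' x) * laplaceOp S F x) +
      ∫ x, p' x * (laplaceOp S F x - laplaceOp S' F x) := by
    simp_rw [sub_mul, mul_sub]
    rw [integral_sub hi1 hi2, integral_sub hi2 hi3, hinv, hinv']
    ring
  have hb1 := (le_abs_self _).trans (abs_integral_sub_mul_le hp hp' hT)
  have hb2 : ∫ x, p' x * (laplaceOp S F x - laplaceOp S' F x) ≤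
      3 / 2 * (d : ℝ) ^ 2 * (l / c) * (C / δ) := by
    calc _ ≤ ∫ x, p' x * (3 / 2 * (d : ℝ) ^ 2 * (l / c) * (C / δ)) := by
          refine integral_mono ?_ (hp'.mul_const _) fun x => ?_
          · simp_rw [mul_sub]
            exact hi2.sub hi3
          · exact mul_le_mul_of_nonneg_left ((le_abs_self _).trans (hT' x))
              (mixtureDensity_nonneg hmax hmin hS' P' x)
      _ = _ := by
          rw [integral_mul_const, integral_mixtureDensity hmax hmin hd hS' P', one_mul]
  have hφi : ∀ (μ : Measure (E d)) [IsProbabilityMeasure μ], Integrable φ μ := fun μ _ =>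
    (integrable_const R).mono' hφ.continuous.measurable.aestronglyMeasurable
      (Filter.Eventually.of_forall hφR)
  have hFi : ∀ (μ : Measure (E d)) [IsProbabilityMeasure μ], Integrable F μ := fun μ _ =>
    (integrable_const (R + δ)).mono' hF.1.continuous.measurable.aestronglyMeasurable
      (Filter.Eventually.of_forall fun x => by
        have h2 := abs_le.1 (hFφ x)
        have h3 := abs_le.1 (hφR x)
        exact abs_le.2 (by constructor <;> linarith))
  have hclose : ∀ (μ : Measure (E d)) [IsProbabilityMeasure μ],
      |∫ θ, F θ ∂μ - ∫ θ, φ θ ∂μ| ≤ δ := fun μ _ => by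
    rw [← integral_sub (hFi μ) (hφi μ)]
    simpa using norm_integral_le_of_norm_le_const (μ := μ) (f := fun θ => F θ - φ θ)
      (Filter.Eventually.of_forall hFφ)
  have h1 := abs_le.1 (hclose P)
  have h2 := abs_le.1 (hclose P')
  have h3 : l * (R + δ + 3 / 2 * (d : ℝ) ^ 2 * C * (lmax + 1 / c) / δ) =
      (R + δ + 3 / 2 * (d : ℝ) ^ 2 * lmax * (C / δ)) * l +
        3 / 2 * (d : ℝ) ^ 2 * (l / c) * (C / δ) := by
    field_simp
    ring
  rw [h3]
  linarith

theorem l1Dist_mixtureDensity_le_two (hmax : 0 < lmax) (hmin : 0 < lmin) (hd : 1 ≤ d)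
    (hS : S ∈ scaleSet d lmin lmax) (hS' : S' ∈ scaleSet d lmin lmax) (P P' : Measure (E d))
    [IsProbabilityMeasure P] [IsProbabilityMeasure P'] :
    l1Dist (mixtureDensity (laplaceKernel d) ⟨P, S⟩) (mixtureDensity (laplaceKernel d) ⟨P', S'⟩)
      ≤ 2 := by
  have hp := integrable_mixtureDensity hmax hmin hd hS P
  have hp' := integrable_mixtureDensity hmax hmin hd hS' P'
  have h : ∫ x, (mixtureDensity (laplaceKernel d) ⟨P, S⟩ x +
      mixtureDensity (laplaceKernel d) ⟨P', S'⟩ x) = 2 := by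
    rw [integral_add hp hp', integral_mixtureDensity hmax hmin hd hS P,
      integral_mixtureDensity hmax hmin hd hS' P']
    norm_num
  rw [← h]
  refine integral_mono (hp.sub hp').abs (hp.add hp') fun x => ?_
  have h1 := mixtureDensity_nonneg hmax hmin hS P x
  have h2 := mixtureDensity_nonneg hmax hmin hS' P' x
  exact abs_le.2 (by constructor <;> simp only <;> linarith)

theorem inverse_bound_laplaceKernel (hmin : 0 < lmin) (hmax : 0 < lmax) (hd : 1 ≤ d)
    (hR : 0 < R) : ∃ C > 0, ∀ X : Set (E d), MeasurableSet X → X ⊆ Metric.closedBall 0 R →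
      ∀ G ∈ mixingClass X lmin lmax, ∀ G' ∈ mixingClass X lmin lmax,
        C * (wasserstein1 G.P G'.P ^ 2 + opNorm (G.S - G'.S)) ≤
          l1Dist (mixtureDensity (laplaceKernel d) G) (mixtureDensity (laplaceKernel d) G') := by
  obtain ⟨A, hA0, hA⟩ := exists_wasserstein1_le hmin hmax hd hR
  obtain ⟨-, c, hc0, hc⟩ := scaleLowerBound_laplaceKernel hmin hmax hd hR
  -- With `r = √l` as smoothing scale, the estimate reads `W ≤ r (2 + r R + l + A)`; the bounds `l ≤
  -- 2` and `r ≤ 2` make the bracket at most `B`.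
  set B := 2 + 2 * R + 2 + A with hB
  refine ⟨(B ^ 2 + 1 / c)⁻¹, by positivity, fun X hXm hX G hG G' hG' => ?_⟩
  have hop := hc X hXm hX G hG G' hG'
  have hW := hA X hXm hX G hG G' hG'
  have hW0 : 0 ≤ wasserstein1 G.P G'.P := ENNReal.toReal_nonneg
  have hl2 : l1Dist (mixtureDensity (laplaceKernel d) G) (mixtureDensity (laplaceKernel d) G')
      ≤ 2 := by
    have := hG.1
    have := hG'.1
    exact l1Dist_mixtureDensity_le_two hmax hmin hd hG.2.2 hG'.2.2 G.P G'.P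
  have hl0 : 0 ≤ l1Dist (mixtureDensity (laplaceKernel d) G)
      (mixtureDensity (laplaceKernel d) G') := integral_nonneg fun x => abs_nonneg _
  generalize l1Dist (mixtureDensity (laplaceKernel d) G) (mixtureDensity (laplaceKernel d) G') = l
    at *
  generalize wasserstein1 G.P G'.P = W at *
  have hop' : opNorm (G.S - G'.S) ≤ 1 / c * l := by
    rw [one_div, inv_mul_eq_div, le_div_iff₀' hc0]
    exact hop
  have hWl : W ^ 2 ≤ B ^ 2 * l := by
    -- For `l = 0` the scale `√l` is not admissible, but then `W ≤ 2δ` for every `δ > 0`.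
    rcases hl0.eq_or_lt with rfl | hl
    · have : W ≤ 0 := le_of_forall_pos_le_add fun ε hε => by
        have := hW (ε / 2) (by positivity)
        linarith
      have : W = 0 := le_antisymm this hW0
      simp [this]
    · set r := Real.sqrt l with hr
      have hr0 : 0 < r := Real.sqrt_pos.2 hl
      have hrl : r ^ 2 = l := Real.sq_sqrt hl0
      have hr2 : r ≤ 2 := by nlinarith
      have h1 := hW r hr0
      have h2 : l * (R + r + A / r) = r * (r * R + l + A) := by
        rw [← hrl]; field_simp
      rw [h2] at h1
      have h3 : r * R ≤ 2 * R := by gcongr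
      have h4 : W ≤ B * r := by
        have : r * (r * R + l + A) ≤ r * (2 * R + 2 + A) := by gcongr
        rw [hB]
        linarith
      calc W ^ 2 ≤ (B * r) ^ 2 := by gcongr
        _ = B ^ 2 * l := by rw [mul_pow, hrl]
  rw [inv_mul_le_iff₀ (by positivity)]
  linarith

end InverseBound

end LaplaceMixture

end

open LaplaceMixture
theorem theorem4p4 (d : ℕ) (hd : 1 ≤ d) (lmin lmax : ℝ) (hmin : 0 < lmin) (hlt : lmin < lmax) :
    OrdinarySmooth (laplaceKernel d) lmin lmax 2 ∧
    ScaleRegularity (laplaceKernel d) lmin lmax (fun t => t) 2 ∧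
    ∀ R : ℝ, 0 < R →
      ScaleLowerBound (laplaceKernel d) R lmin lmax (fun t => t) ∧
      (∀ X : Set (E d), MeasurableSet X → X ⊆ Metric.closedBall 0 R →
        PDEInversion (laplaceKernel d) X lmin lmax 2 laplaceOp) ∧
      ∃ C > 0, ∀ X : Set (E d), MeasurableSet X → X ⊆ Metric.closedBall 0 R →
        ∀ G ∈ mixingClass X lmin lmax, ∀ G' ∈ mixingClass X lmin lmax,
          C * (wasserstein1 G.P G'.P ^ 2 + opNorm (G.S - G'.S)) ≤
            l1Dist (mixtureDensity (laplaceKernel d) G)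
              (mixtureDensity (laplaceKernel d) G') := by
  have hmax : 0 < lmax := hmin.trans hlt
  exact ⟨ordinarySmooth_laplaceKernel hmin hmax hd, scaleRegularity_laplaceKernel hmin hmax hd,
    fun R hR => ⟨scaleLowerBound_laplaceKernel hmin hmax hd hR,
      fun X _ _ => pdeInversion_laplaceKernel hmin hmax hd X,
      inverse_bound_laplaceKernel hmin hmax hd hR⟩⟩
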